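/- \textbf{Setting.} Let $q(y\mid x)$ be a discrete memoryless channel with finite input alphabet $\mathcal X\neq\emptyset$ and finite output alphabet $\mathcal Y$, and let $\beta\in[0,1]$. There are infinitely many sensors, numbered $1,2,\dots$; each sensor is Byzantine with probability $\beta$, independently of the others, and honest otherwise. The fusion center and the honest sensors do not know which sensors are Byzantine. A message $W$, uniform on $\{1,\dots,M\}$, is known to all sensors. \emph{Code.} In each time slot $t=1,2,\dots$ the fusion center polls a sensor $K_t$ and sends it side information $A_t$ from a countably infinite alphabet without error. The choice of $(K_t,A_t)$ may be random and may depend on the fusion center's past observations $K^{t-1},A^{t-1},Y^{t-1}$. The polled sensor sends a symbol $X_t\in\mathcal X$, and the fusion center receives $Y_t\in\mathcal Y$, where $Y_t$ has the law $q(\cdot\mid X_t)$ given $X_t$ and the past. An honest sensor $K_t$ chooses $X_t$, possibly at random, on the basis of $W$, its own number, $K^{t-1}$, $Y^{t-1}$, the side information sent to it up to and including time $t$, and its own earlier transmissions. After receiving $Y_t$ the fusion center decides, possibly at random, on the basis of its observations $K^t,A^t,Y^t$, whether to continue polling or to stop and output an estimate $\hat W\in\{1,\dots,M\}$. A code consists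 of $M\ge1$ and these rules of the fusion center and the honest sensors. \emph{Attack.} The Byzantine sensors know the code and act jointly: if $K_t$ is Byzantine, then $X_t$ is chosen, possibly at random, on the basis of the set of all Byzantine sensors, $W$, $K^t$, $A^t$, $X^{t-1}$ and $Y^{t-1}$. \emph{Capacity.} Let $N\ge1$ be the number of time slots until the fusion center stops ($N=\infty$ if it never does). The probability of error is $P_e=\Pr(\hat W\ne W)$, where a session that never stops counts as an error, and the rate is $\log M/\mathbb E(N)$, which is $0$ if $\mathbb E(N)=\infty$; both depend on the attack. A number $R\in\mathbb R$ is \emph{achievable} if for every $\varepsilon>0$ there is a code which under every attack has rate larger than $R-\varepsilon$ and probability of error less than $\varepsilon$. The capacity $C^{\mathrm{byz}}$ is the maximum of all achievable $R$. \textbf{Theorem.} Let $C=\max_{p(x)}I(X;Y)$ be the Shannon capacity of the channel $q(y\mid x)$, with the same base of logarithms as in the rate. The maximum defining $C$ is attained, the capacity $C^{\mathrm{byz}}$ (a maximum) exists, and \[ C^{\mathrm{byz}}=\begin{cases}C,&\text{if }\beta<1/2,\\[2pt]0,&\text{if }\beta\ge 1/2.\end{cases} \] -/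

import Mathlib

open MeasureTheory ProbabilityTheory
open scoped ENNReal

noncomputable section

namespace ByzantineFusion

/-! ### Shannon capacity of a discrete memoryless channel

A discrete memoryless channel with input alphabet `X` and output alphabet `Y` is a map
`q : X → PMF Y`, where `q x y` is the transition probability `q(y|x)`. All logarithms are natural,
for the mutual information as well as for the rate of a code. -/

/-- The mutual information
`I(X;Y) = ∑ x, ∑ y, p(x) q(y|x) log (q(y|x) / ∑ x', p(x') q(y|x'))` of the input and the output of
the channel `q` when the input has distribution `p`. -/
def mutualInfo {X Y : Type*} [Fintype X] [Fintype Y] (q : X → PMF Y) (p : PMF X) : ℝ :=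
  ∑ x, ∑ y, (p x).toReal * (q x y).toReal *
    Real.log ((q x y).toReal / ∑ x', (p x').toReal * (q x' y).toReal)

/-- `C = sup_p I(X;Y)`. -/
def shannonCapacity {X Y : Type*} [Fintype X] [Fintype Y] (q : X → PMF Y) : ℝ :=
  sSup (Set.range (mutualInfo q))

/-! ### The polling protocol

The sensors are numbered by `ℕ`. -/

/-- What happens in one time slot `t`: the polled sensor `K_t`, the side information that the fusion
center sends to it over the error-free polling channel of infinite capacity (an element of a
countably infinite alphabet, e.g. a finite string of any length), the symbol `X_t` sent and the
symbol `Y_t` received. -/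
structure Round (X Y : Type*) where
  sensor : ℕ
  info : ℕ
  sent : X
  received : Y

/-- The past time slots, the most recent one first. -/
abbrev History (X Y : Type*) := List (Round X Y)

/-- What the fusion center has observed: everything except the transmitted symbols. -/
def fusionView {X Y : Type*} (h : History X Y) : List (ℕ × ℕ × Y) :=
  h.map fun r => (r.sensor, r.info, r.received)

/-- What the honest sensor `k` has observed: the polling history, all symbols received by the fusion
center, the side information sent to `k` itself, and the symbols that `k` itself has sent. -/
def sensorView {X Y : Type*} (k : ℕ) (h : History X Y) : List (ℕ × Y × Option (ℕ × X)) :=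
  h.map fun r => (r.sensor, r.received, if r.sensor = k then some (r.info, r.sent) else none)

/-- A variable-length code with `M` messages: the algorithm of the fusion center and of the honest
sensors. All decisions may be randomized; a strategy with private memory is described by its
conditional distributions given what its owner has observed. -/
structure Code (X Y : Type*) (M : ℕ) where
  /-- the choice of the next sensor and of the side information sent to it -/
  poll : List (ℕ × ℕ × Y) → PMF (ℕ × ℕ)
  /-- the symbol that an honest sensor sends when it is polled, as a function of its number, of the
  message, of its past observations, and of the side information that comes with the poll -/
  encode : ℕ → Fin M → List (ℕ × Y × Option (ℕ × X)) → ℕ → PMF X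
  /-- the choice, after each received symbol, between another poll (`none`) and stopping with a
  decoded message `w` (`some w`) -/
  decide : List (ℕ × ℕ × Y) → PMF (Option (Fin M))

/-- A joint strategy of the Byzantine sensors. The distribution of the symbol that a polled Byzantine
sensor sends may depend on the set of all Byzantine sensors, on the true message, on everything that
has been polled, sent and received by any sensor so far, and on the current poll and its side
information. -/
structure Attack (X Y : Type*) (M : ℕ) where
  send : Set ℕ → Fin M → History X Y → ℕ → ℕ → PMF X
  measurable_send : ∀ w h k a x, Measurable fun S => send S w h k a x

/-- The past time slots, and the decoded message once the polling has stopped. -/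
abbrev State (X Y : Type*) (M : ℕ) := History X Y × Option (Fin M)

section Law

variable {X Y : Type*} {M : ℕ} (q : X → PMF Y) (c : Code X Y M) (A : Attack X Y M)

open scoped Classical in
/-- One time slot, if `S` is the set of Byzantine sensors and `w` is the message: poll, transmit,
receive, and decide whether to stop. Nothing happens after the polling has stopped. -/
def step (S : Set ℕ) (w : Fin M) : State X Y M → PMF (State X Y M)
  | (h, some v) => PMF.pure (h, some v)
  | (h, none) =>
      (c.poll (fusionView h)).bind fun ka =>
        (if ka.1 ∈ S then A.send S w h ka.1 ka.2
          else c.encode ka.1 w (sensorView ka.1 h) ka.2).bind fun x =>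
          (q x).bind fun y =>
            (c.decide (fusionView (⟨ka.1, ka.2, x, y⟩ :: h))).map fun d =>
              (⟨ka.1, ka.2, x, y⟩ :: h, d)

/-- The distribution of the state after the first `n` time slots. -/
def run (S : Set ℕ) (w : Fin M) : ℕ → PMF (State X Y M)
  | 0 => PMF.pure ([], none)
  | n + 1 => (run S w n).bind (step q c A S w)

/-- The conditional probability, given `S` and `W = w`, that the decoded message after the first `n`
time slots is `d`, where `d = none` means that polling goes on, i.e. `N > n`. -/
def decisionProb (S : Set ℕ) (w : Fin M) (n : ℕ) (d : Option (Fin M)) : ℝ≥0∞ :=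
  ((run q c A S w n).map Prod.snd) d

/-- The conditional probability that a session ends with the correct message. The events in the
supremum increase with `n`. -/
def correctProb (S : Set ℕ) (w : Fin M) : ℝ≥0∞ :=
  ⨆ n, decisionProb q c A S w n (some w)

/-- `E[N | S, W = w] = ∑ n, P(N > n | S, W = w)`, where `N` (possibly infinite) is the number of
symbols sent. -/
def expectedLengthGiven (S : Set ℕ) (w : Fin M) : ℝ≥0∞ :=
  ∑' n, decisionProb q c A S w n none

/-- The probability of error `P_e`: the message is uniform, and each sensor is Byzantine with
probability `β`, independently. A session that never ends counts as an error. -/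
def errorProb (β : unitInterval) : ℝ≥0∞ :=
  ∫⁻ S, (∑ w, (1 - correctProb q c A S w)) / M ∂(setBernoulli (Set.univ : Set ℕ) β)

/-- The expected number `E[N]` of symbols sent. -/
def expectedLength (β : unitInterval) : ℝ≥0∞ :=
  ∫⁻ S, (∑ w, expectedLengthGiven q c A S w) / M ∂(setBernoulli (Set.univ : Set ℕ) β)

/-- The rate `log M / E[N]`. Since `N ≥ 1`, the only degenerate case is `E[N] = ∞`, in which the
rate is `0`. -/
def rate (β : unitInterval) : ℝ :=
  Real.log M / (expectedLength q c A β).toReal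

end Law

/-- The rate `R` is achievable if for every `ε > 0` some code has rate larger than `R - ε` and
probability of error less than `ε`, whatever the Byzantine sensors, who know the code, do. -/
def Achievable {X Y : Type*} (q : X → PMF Y) (β : unitInterval) (R : ℝ) : Prop :=
  ∀ ε : ℝ, 0 < ε → ∃ M : ℕ, 0 < M ∧ ∃ c : Code X Y M, ∀ A : Attack X Y M,
    errorProb q c A β < ENNReal.ofReal ε ∧ R - ε < rate q c A β

end ByzantineFusion

end

/-!
# Byzantine sensors and the capacity of a fusion center

The theorem has four ingredients.

*The maximum.* Written as a difference of entropies, the mutual information is continuous on the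
compact simplex of input distributions. A maximizer `p`, with output distribution `r`, satisfies the
Kuhn-Tucker condition `D(q(·|x) ‖ r) ≤ C` for every letter `x` (`exists_capacity_achieving`).

*The converse.* Suppose that the Byzantine sensors simply follow the code. By the Kuhn-Tucker
condition the log-likelihood ratio of the received symbols, between the channel and noise with
distribution `r`, has mean at most `C E[N]`. Under the noise the decision is independent of the
message, so it is correct with probability at most `1 / M`. Comparing the two by means of
`1 + u ≤ exp u` gives `(1 - P_e) log (M s) ≤ C E[N] + log (1 + s)` for all `s ≥ 1`
(`log_mul_sum_correctProb_le`). Since `E[N] ≥ 1`, letting `P_e → 0` and then `s → ∞` bounds the rate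
by `C`. The parameter `s` is needed because `M` and `E[N]` need not be large.

*A Byzantine majority.* If `β = 1 / 2`, then the set `S` of Byzantine sensors has the same law as
its complement. Let the Byzantine sensors behave like honest sensors with the message `π w` instead
of `w`, for a permutation `π` without fixed points. The session with Byzantine set `S` and message
`w` is then the same as the session with Byzantine set `Sᶜ`, message `π w` and permutation `π⁻¹`,
and the fusion center cannot be right in both (`correctProb_add_correctProb_le_one`), so one of the
two attacks has error probability at least `1 / 2`. For larger `β` the attack is confined to those
Byzantine sensors that belong to a fixed set `R`; averaging over a Bernoulli set `R` reduces
this case to `β = 1 / 2`.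

*A Byzantine minority.* A code of fixed length achieves `C`. By Chernoff's bound a large committee
of `m` sensors has an honest majority with high probability. Time is divided into blocks, in each of
which one symbol of an alphabet `Fin B` is sent with a block code for the channel
(`exists_block_code`, proved with Feinstein's greedy construction), and the blocks are grouped into
rounds. In a round one committee member transmits `G` digits of the message; every member of the
committee, knowing what has been received, then votes with one block on whether these digits are
right. After a rejection the next committee member takes over as transmitter. If the committee has
an honest majority and the blocks of the honest sensors are decoded correctly, then all votes come
out right, an honest transmitter is never replaced, and fewer than `m` rounds are rejected;
so `J + m` rounds suffice for `J * G` digits (`digit_eq_of_accepted`). The overhead factor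
`(J + m) (G + m) / (J G)` is close to `1` for large `J` and `G`. The Byzantine sensors do not
influence the blocks of honest sensors, so the probability that one of these is misunderstood is
controlled by a supermartingale and a union bound (`BlockScheme.one_sub_correctProb_code_le`).
-/

noncomputable section

namespace ByzantineFusion

/-! ### Expectations of nonnegative functions of a discrete random variable -/

section Mean

variable {α γ : Type*}

/-- The expectation of the nonnegative function `f` under the distribution `p`. -/
def mean (p : PMF α) (f : α → ℝ≥0∞) : ℝ≥0∞ := ∑' a, p a * f a

lemma mean_pure (a : α) (f : α → ℝ≥0∞) : mean (PMF.pure a) f = f a := by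
  classical
  unfold mean
  rw [tsum_eq_single a]
  · simp
  · intro b hb
    simp [PMF.pure_apply, hb]

lemma mean_bind (p : PMF α) (k : α → PMF γ) (f : γ → ℝ≥0∞) :
    mean (p.bind k) f = mean p fun a => mean (k a) f := by
  simp only [mean, PMF.bind_apply, ← ENNReal.tsum_mul_right, ← ENNReal.tsum_mul_left, mul_assoc]
  exact ENNReal.tsum_comm

lemma mean_map (p : PMF α) (g : α → γ) (f : γ → ℝ≥0∞) :
    mean (p.map g) f = mean p fun a => f (g a) := by
  simp only [PMF.map, mean_bind, Function.comp, mean_pure]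

lemma mean_mono (p : PMF α) {f g : α → ℝ≥0∞} (h : ∀ a, p a ≠ 0 → f a ≤ g a) :
    mean p f ≤ mean p g := by
  refine ENNReal.tsum_le_tsum fun a => ?_
  by_cases ha : p a = 0
  · simp [ha]
  · exact mul_le_mul_right (h a ha) _

lemma mean_congr (p : PMF α) {f g : α → ℝ≥0∞} (h : ∀ a, p a ≠ 0 → f a = g a) :
    mean p f = mean p g :=
  le_antisymm (mean_mono p fun a ha => (h a ha).le) (mean_mono p fun a ha => (h a ha).ge)

lemma mean_const (p : PMF α) (b : ℝ≥0∞) : mean p (fun _ => b) = b := by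
  simp [mean, ENNReal.tsum_mul_right, p.tsum_coe]

lemma mean_add (p : PMF α) (f g : α → ℝ≥0∞) :
    mean p (fun a => f a + g a) = mean p f + mean p g := by
  simp [mean, mul_add, ENNReal.tsum_add]

lemma mean_mul_left (p : PMF α) (b : ℝ≥0∞) (f : α → ℝ≥0∞) :
    mean p (fun a => b * f a) = b * mean p f := by
  simp [mean, ← ENNReal.tsum_mul_left, mul_left_comm]

lemma mean_sum {ι : Type*} (p : PMF α) (s : Finset ι) (f : ι → α → ℝ≥0∞) :
    mean p (fun a => ∑ i ∈ s, f i a) = ∑ i ∈ s, mean p (f i) := by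
  classical
  induction s using Finset.induction_on with
  | empty => simp [mean]
  | insert i s hi ih => simp [Finset.sum_insert hi, mean_add, ih]

lemma map_apply_eq_mean [DecidableEq γ] (p : PMF α) (g : α → γ) (b : γ) :
    (p.map g) b = mean p fun a => if g a = b then 1 else 0 := by
  rw [PMF.map_apply]
  refine tsum_congr fun a => ?_
  by_cases h : g a = b
  · simp [h]
  · simp [h, Ne.symm h]

lemma mean_fintype [Fintype α] (p : PMF α) (f : α → ℝ≥0∞) : mean p f = ∑ a, p a * f a :=
  tsum_fintype _

end Mean

/-! ### One time slot of the protocol -/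

section Protocol

variable {X Y : Type*} {M : ℕ} (q : X → PMF Y) (c : Code X Y M) (A : Attack X Y M)
  (S : Set ℕ) (w : Fin M)

lemma mean_step_stopped (h : History X Y) (v : Fin M) (f : State X Y M → ℝ≥0∞) :
    mean (step q c A S w (h, some v)) f = f (h, some v) := mean_pure _ _

open scoped Classical in
lemma mean_step (h : History X Y) (f : State X Y M → ℝ≥0∞) :
    mean (step q c A S w (h, none)) f =
      mean (c.poll (fusionView h)) fun ka =>
        mean (if ka.1 ∈ S then A.send S w h ka.1 ka.2
          else c.encode ka.1 w (sensorView ka.1 h) ka.2) fun x =>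
          mean (q x) fun y =>
            mean (c.decide (fusionView (⟨ka.1, ka.2, x, y⟩ :: h))) fun d =>
              f (⟨ka.1, ka.2, x, y⟩ :: h, d) := by
  simp only [step, mean_bind, mean_map]

lemma mean_run_succ (n : ℕ) (f : State X Y M → ℝ≥0∞) :
    mean (run q c A S w (n + 1)) f =
      mean (run q c A S w n) fun s => mean (step q c A S w s) f :=
  mean_bind _ _ _

lemma mean_run_zero (f : State X Y M → ℝ≥0∞) : mean (run q c A S w 0) f = f ([], none) :=
  mean_pure _ _

lemma decisionProb_eq_mean (n : ℕ) (d : Option (Fin M)) :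
    decisionProb q c A S w n d = mean (run q c A S w n) fun s => if s.2 = d then 1 else 0 :=
  map_apply_eq_mean _ _ _

lemma decisionProb_le_one (n : ℕ) (d : Option (Fin M)) : decisionProb q c A S w n d ≤ 1 :=
  PMF.coe_le_one _ _

lemma correctProb_le_one : correctProb q c A S w ≤ 1 :=
  iSup_le fun _ => decisionProb_le_one ..

end Protocol

/-! ### Capacity-achieving input distributions -/

section Capacity

open Filter Topology

lemma sum_toReal_eq_one {α : Type*} [Fintype α] (p : PMF α) : ∑ a, (p a).toReal = 1 := by
  rw [← ENNReal.toReal_sum fun a _ => p.apply_ne_top a, ← tsum_fintype (L := .unconditional α),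
    p.tsum_coe, ENNReal.toReal_one]

lemma sub_le_mul_log_div {a b : ℝ} (ha : 0 ≤ a) (hb : 0 ≤ b) (h : a ≠ 0 → b ≠ 0) :
    a - b ≤ a * Real.log (a / b) := by
  rcases eq_or_lt_of_le ha with rfl | ha
  · simpa using hb
  have hb' : 0 < b := lt_of_le_of_ne hb (h ha.ne').symm
  have h2 := mul_le_mul_of_nonneg_left (Real.one_sub_inv_le_log_of_pos (div_pos ha hb')) ha.le
  rwa [inv_div, mul_sub, mul_one, mul_div_cancel₀ _ ha.ne'] at h2

variable {X Y : Type*} [Fintype X] [Fintype Y] (q : X → PMF Y)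

omit [Fintype Y] in
lemma bind_toReal (p : PMF X) (y : Y) :
    (p.bind q y).toReal = ∑ x, (p x).toReal * (q x y).toReal := by
  rw [PMF.bind_apply, tsum_fintype, ENNReal.toReal_sum]
  · simp
  · exact fun x _ => ENNReal.mul_ne_top (p.apply_ne_top x) ((q x).apply_ne_top y)

lemma mutualInfo_eq (p : PMF X) :
    mutualInfo q p = ∑ x, ∑ y, (p x).toReal * (q x y).toReal *
      Real.log ((q x y).toReal / (p.bind q y).toReal) := by
  simp only [mutualInfo, bind_toReal]

/-- The mutual information as the difference of output entropy and noise entropy; unlike the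
defining formula it is visibly continuous in the input distribution, also at the boundary of the
simplex. -/
lemma mutualInfo_eq_entropy_sub (p : PMF X) :
    mutualInfo q p =
      ∑ x, (p x).toReal * ∑ y, (q x y).toReal * Real.log (q x y).toReal -
        ∑ y, (∑ x, (p x).toReal * (q x y).toReal) *
          Real.log (∑ x, (p x).toReal * (q x y).toReal) := by
  have h : ∀ x y, (p x).toReal * (q x y).toReal *
      Real.log ((q x y).toReal / ∑ x', (p x').toReal * (q x' y).toReal) =
      (p x).toReal * ((q x y).toReal * Real.log (q x y).toReal) -
      (p x).toReal * (q x y).toReal * Real.log (∑ x', (p x').toReal * (q x' y).toReal) := by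
    intro x y
    by_cases h0 : (p x).toReal * (q x y).toReal = 0
    · rw [h0, ← mul_assoc, h0]; simp
    · have hpos : 0 < ∑ x', (p x').toReal * (q x' y).toReal := by
        refine Finset.sum_pos' (fun _ _ => by positivity) ⟨x, Finset.mem_univ _, ?_⟩
        exact lt_of_le_of_ne (by positivity) (Ne.symm h0)
      rw [Real.log_div (right_ne_zero_of_mul h0) hpos.ne']
      ring
  simp only [mutualInfo, h, Finset.sum_sub_distrib, Finset.mul_sum, Finset.sum_mul]
  congr 1
  exact Finset.sum_comm

lemma exists_pmf_of_mem_stdSimplex {α : Type*} [Fintype α] {v : α → ℝ}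
    (hv : v ∈ stdSimplex ℝ α) : ∃ p : PMF α, ∀ a, (p a).toReal = v a := by
  have hsum : ∑ x, ENNReal.ofReal (v x) = 1 := by
    rw [← ENNReal.ofReal_sum_of_nonneg fun x _ => hv.1 x, hv.2, ENNReal.ofReal_one]
  exact ⟨PMF.ofFintype _ hsum, fun a => by simp [ENNReal.toReal_ofReal (hv.1 a)]⟩

/-- The mutual information is a continuous function on the compact simplex. -/
theorem exists_forall_mutualInfo_le [Nonempty X] :
    ∃ p : PMF X, ∀ p' : PMF X, mutualInfo q p' ≤ mutualInfo q p := by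
  classical
  set J : (X → ℝ) → ℝ := fun v =>
    ∑ x, v x * ∑ y, (q x y).toReal * Real.log (q x y).toReal -
        ∑ y, (∑ x, v x * (q x y).toReal) * Real.log (∑ x, v x * (q x y).toReal) with hJ
  have hcont : Continuous J := by
    refine Continuous.sub (by fun_prop) (continuous_finsetSum _ fun y _ => ?_)
    exact Real.continuous_mul_log.comp (by fun_prop : Continuous fun v : X → ℝ =>
      ∑ x, v x * (q x y).toReal)
  obtain ⟨v, hv, hmax⟩ := (isCompact_stdSimplex ℝ X).exists_isMaxOn
    ⟨_, single_mem_stdSimplex ℝ (Classical.arbitrary X)⟩ hcont.continuousOn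
  obtain ⟨p, hp⟩ := exists_pmf_of_mem_stdSimplex hv
  refine ⟨p, fun p' => ?_⟩
  rw [mutualInfo_eq_entropy_sub, mutualInfo_eq_entropy_sub]
  have := hmax (show (fun x => (p' x).toReal) ∈ stdSimplex ℝ X from
    ⟨fun x => ENNReal.toReal_nonneg, sum_toReal_eq_one p'⟩)
  simpa [hJ, hp] using this

theorem isGreatest_shannonCapacity [Nonempty X] :
    IsGreatest (Set.range (mutualInfo q)) (shannonCapacity q) := by
  obtain ⟨p, hp⟩ := exists_forall_mutualInfo_le q
  have h : IsGreatest (Set.range (mutualInfo q)) (mutualInfo q p) :=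
    ⟨⟨p, rfl⟩, by rintro _ ⟨p', rfl⟩; exact hp p'⟩
  rwa [shannonCapacity, h.csSup_eq]

/-- Gibbs' inequality: measuring the information densities against another output distribution
`r` than the true one can only increase their average. -/
lemma mutualInfo_le_sum_log_div (p : PMF X) (r : Y → ℝ) (hr0 : ∀ y, 0 ≤ r y)
    (hr1 : ∑ y, r y = 1) (hr : ∀ y, p.bind q y ≠ 0 → r y ≠ 0) :
    mutualInfo q p ≤
      ∑ x, (p x).toReal * ∑ y, (q x y).toReal * Real.log ((q x y).toReal / r y) := by
  set u : Y → ℝ := fun y => (p.bind q y).toReal with hu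
  have hterm : ∀ x y, (p x).toReal * (q x y).toReal * Real.log ((q x y).toReal / u y) +
      ((p x).toReal * (q x y).toReal - (p x).toReal * (q x y).toReal * (r y / u y)) ≤
      (p x).toReal * ((q x y).toReal * Real.log ((q x y).toReal / r y)) := by
    intro x y
    by_cases h0 : (p x).toReal * (q x y).toReal = 0
    · rw [h0, ← mul_assoc, h0]; simp
    have hq : (q x y).toReal ≠ 0 := right_ne_zero_of_mul h0
    have hupos : 0 < u y := by
      rw [hu]; simp only [bind_toReal]
      exact Finset.sum_pos' (fun _ _ => by positivity)
        ⟨x, Finset.mem_univ _, lt_of_le_of_ne (by positivity) (Ne.symm h0)⟩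
    have hrpos : 0 < r y := by
      refine lt_of_le_of_ne (hr0 y) (Ne.symm (hr y ?_))
      intro h; exact hupos.ne' (by rw [hu]; simp only [h, ENNReal.toReal_zero])
    have hlog : Real.log ((q x y).toReal / u y) - Real.log ((q x y).toReal / r y) =
        Real.log (r y / u y) := by
      rw [Real.log_div hq hupos.ne', Real.log_div hq hrpos.ne', Real.log_div hrpos.ne' hupos.ne']
      ring
    have h1 := Real.log_le_sub_one_of_pos (div_pos hrpos hupos)
    have hpq : 0 ≤ (p x).toReal * (q x y).toReal := by positivity
    have := mul_le_mul_of_nonneg_left (hlog.trans_le h1) hpq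
    linarith
  have hsum := Finset.sum_le_sum fun x (_ : x ∈ Finset.univ) =>
    Finset.sum_le_sum fun y (_ : y ∈ Finset.univ) => hterm x y
  simp only [Finset.sum_add_distrib, Finset.sum_sub_distrib, ← Finset.mul_sum] at hsum
  rw [← show mutualInfo q p = ∑ x, ∑ y, (p x).toReal * (q x y).toReal *
      Real.log ((q x y).toReal / u y) from mutualInfo_eq q p] at hsum
  have h1 : ∑ x, (p x).toReal * ∑ y, (q x y).toReal = 1 := by
    simp only [sum_toReal_eq_one, mul_one]
  have h2 : ∑ x, ∑ y, (p x).toReal * (q x y).toReal * (r y / u y) ≤ 1 := by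
    rw [Finset.sum_comm, ← hr1]
    refine Finset.sum_le_sum fun y _ => ?_
    rw [← Finset.sum_mul, ← bind_toReal]
    by_cases h : u y = 0
    · simpa [h] using hr0 y
    · exact (mul_div_cancel₀ _ h).le
  linarith

/-- The Kuhn-Tucker property of a capacity-achieving input distribution `p`: relative to its output
distribution no input letter carries more information than the capacity. -/
theorem exists_capacity_achieving [Nonempty X] :
    ∃ p : PMF X, mutualInfo q p = shannonCapacity q ∧
      (∀ x y, q x y ≠ 0 → p.bind q y ≠ 0) ∧
      ∀ x, ∑ y, (q x y).toReal * Real.log ((q x y).toReal / (p.bind q y).toReal) ≤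
        shannonCapacity q := by
  classical
  obtain ⟨⟨p, hp⟩, hmax⟩ := isGreatest_shannonCapacity q
  set C := shannonCapacity q
  set u : Y → ℝ := fun y => (p.bind q y).toReal with hu
  have hu0 : ∀ y, 0 ≤ u y := fun y => ENNReal.toReal_nonneg
  have hu1 : ∑ y, u y = 1 := sum_toReal_eq_one _
  set r : X → ℝ → Y → ℝ := fun x t y => (1 - t) * u y + t * (q x y).toReal with hr
  -- Moving from `p` towards the letter `x` does not increase the mutual information.
  have key : ∀ x, ∀ t ∈ Set.Ioo (0 : ℝ) 1,
      ∑ y, (q x y).toReal * Real.log ((q x y).toReal / r x t y) ≤ C := by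
    rintro x t ⟨ht0, ht1⟩
    have hmem : (fun a => (1 - t) * (p a).toReal + t * (if a = x then 1 else 0)) ∈
        stdSimplex ℝ X := by
      refine ⟨fun a => ?_, ?_⟩
      · have : 0 ≤ 1 - t := by linarith
        have := mul_nonneg this (ENNReal.toReal_nonneg (a := p a))
        dsimp only
        split_ifs <;> linarith
      · simp [Finset.sum_add_distrib, ← Finset.mul_sum, sum_toReal_eq_one]
    obtain ⟨pt, hpt⟩ := exists_pmf_of_mem_stdSimplex hmem
    have hout : ∀ y, (pt.bind q y).toReal = r x t y := by
      intro y
      simp only [bind_toReal, hpt, hr, hu, add_mul, Finset.sum_add_distrib, mul_assoc,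
        ← Finset.mul_sum]
      simp
    have hI := hmax ⟨pt, rfl⟩
    rw [mutualInfo_eq] at hI
    simp only [hout, hpt, mul_assoc, ← Finset.mul_sum] at hI
    have hg := mutualInfo_le_sum_log_div q p (r x t)
      (fun y => add_nonneg (mul_nonneg (by linarith) (hu0 y))
        (mul_nonneg ht0.le ENNReal.toReal_nonneg))
      (by simp [hr, Finset.sum_add_distrib, ← Finset.mul_sum, hu1, sum_toReal_eq_one])
      (fun y hy => by
        have : 0 < u y := ENNReal.toReal_pos hy ((p.bind q).apply_ne_top y)
        have h1 : 0 < (1 - t) * u y := mul_pos (by linarith) this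
        have h2 : 0 ≤ t * (q x y).toReal := mul_nonneg ht0.le ENNReal.toReal_nonneg
        exact (add_pos_of_pos_of_nonneg h1 h2).ne')
    rw [hp] at hg
    simp only [add_mul, Finset.sum_add_distrib, mul_assoc, ← Finset.mul_sum, ite_mul, one_mul,
      zero_mul, Finset.sum_ite_eq', Finset.mem_univ, if_true] at hI
    have := mul_le_mul_of_nonneg_left hg (by linarith : 0 ≤ 1 - t)
    have h3 : t * ∑ y, (q x y).toReal * Real.log ((q x y).toReal / r x t y) ≤ t * C := by
      linarith
    exact le_of_mul_le_mul_left h3 ht0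
  have hsupp : ∀ x y, q x y ≠ 0 → p.bind q y ≠ 0 := by
    intro x y₀ hq h0
    set a := (q x y₀).toReal
    have ha : 0 < a := ENNReal.toReal_pos hq ((q x).apply_ne_top y₀)
    have hu00 : u y₀ = 0 := by rw [hu]; simp only [h0, ENNReal.toReal_zero]
    -- The contribution of `y₀` would tend to infinity as `t → 0`.
    set t := Real.exp (-((|C| + 2) / a))
    have ht0 : 0 < t := Real.exp_pos _
    have ht1 : t < 1 := by
      rw [Real.exp_lt_one_iff]
      have : 0 < (|C| + 2) / a := by positivity
      linarith
    have hk := key x t ⟨ht0, ht1⟩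
    have hr0 : ∀ y, 0 ≤ r x t y := fun y => add_nonneg (mul_nonneg (by linarith) (hu0 y))
        (mul_nonneg ht0.le ENNReal.toReal_nonneg)
    have hterm : ∀ y, -r x t y ≤ (q x y).toReal * Real.log ((q x y).toReal / r x t y) := by
      intro y
      have hq0 : 0 ≤ (q x y).toReal := ENNReal.toReal_nonneg
      refine le_trans (by linarith) (sub_le_mul_log_div hq0 (hr0 y) fun h => ?_)
      exact (add_pos_of_nonneg_of_pos (mul_nonneg (by linarith) (hu0 y))
        (mul_pos ht0 (lt_of_le_of_ne hq0 h.symm))).ne'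
    have hy₀ : (q x y₀).toReal * Real.log ((q x y₀).toReal / r x t y₀) = |C| + 2 := by
      have : r x t y₀ = t * a := by simp [hr, hu00, a]
      rw [this]
      change a * Real.log (a / (t * a)) = _
      rw [show a / (t * a) = t⁻¹ by field_simp, Real.log_inv, Real.log_exp]
      field_simp
    have hsum : ∑ y, r x t y = 1 := by
      simp [hr, Finset.sum_add_distrib, ← Finset.mul_sum, hu1, sum_toReal_eq_one]
    rw [← Finset.add_sum_erase _ _ (Finset.mem_univ y₀), hy₀] at hk
    have h5 := Finset.sum_le_sum fun y (_ : y ∈ Finset.univ.erase y₀) => hterm y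
    rw [Finset.sum_neg_distrib] at h5
    have h6 : ∑ y ∈ Finset.univ.erase y₀, r x t y ≤ 1 := by
      rw [← hsum]
      exact Finset.sum_le_sum_of_subset_of_nonneg (Finset.erase_subset _ _) fun y _ _ => hr0 y
    have := le_abs_self C
    linarith
  refine ⟨p, hp, hsupp, fun x => ?_⟩
  have hlim : Tendsto (fun t => ∑ y, (q x y).toReal * Real.log ((q x y).toReal / r x t y))
      (𝓝[>] 0) (𝓝 (∑ y, (q x y).toReal * Real.log ((q x y).toReal / u y))) := by
    refine tendsto_finsetSum _ fun y _ => ?_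
    by_cases h : q x y = 0
    · simp [h]
    have hqpos : 0 < (q x y).toReal := ENNReal.toReal_pos h ((q x).apply_ne_top y)
    have hupos : 0 < u y := ENNReal.toReal_pos (hsupp x y h) ((p.bind q).apply_ne_top y)
    refine Tendsto.mono_left ?_ nhdsWithin_le_nhds
    refine Tendsto.const_mul _ (Tendsto.log (Tendsto.div tendsto_const_nhds ?_ hupos.ne')
      (div_pos hqpos hupos).ne')
    have : Continuous fun t => r x t y := by simp only [hr]; fun_prop
    simpa [hr] using this.tendsto 0
  refine le_of_tendsto hlim ?_
  filter_upwards [Ioo_mem_nhdsGT (zero_lt_one' ℝ)] with t ht using key x t ht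

end Capacity

/-! ### The channel coding theorem -/

section Coding

open Filter Topology

/-- Feinstein's maximal code lemma. If under the input distribution `P` the likelihood ratio
`W x y / r y` is at least `γ` except with probability `κ`, then there are `k` codewords with
disjoint decoding sets and maximal error probability `η`, as long as `k ≤ γ (η - κ)`. A code with
fewer words is extended greedily: its decoding sets cover output probability at most `k / γ`, so if
no codeword could be added, the average of the probability of a large likelihood ratio would be too
small. -/
lemma exists_feinstein_code {α γ' : Type*} [Fintype α] [Fintype γ'] (P : α → ℝ)
    (W : α → γ' → ℝ) (r : γ' → ℝ) (hP0 : ∀ x, 0 ≤ P x) (hP1 : ∑ x, P x = 1)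
    (hW0 : ∀ x y, 0 ≤ W x y) (hW1 : ∀ x, ∑ y, W x y = 1) (hr : ∀ y, ∑ x, P x * W x y = r y)
    {γ κ η : ℝ} (hγ : 0 < γ) (hκ : ∑ x, P x * ∑ y with W x y < γ * r y, W x y ≤ κ) (k : ℕ)
    (hk : k ≤ γ * (η - κ)) :
    ∃ (cw : Fin k → α) (D : Fin k → Finset γ'), Pairwise (fun i j => Disjoint (D i) (D j)) ∧
      (∀ i, ∀ y ∈ D i, γ * r y ≤ W (cw i) y) ∧ ∀ i, 1 - η ≤ ∑ y ∈ D i, W (cw i) y := by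
  classical
  induction k with
  | zero => exact ⟨Fin.elim0, Fin.elim0, fun i => i.elim0, fun i => i.elim0, fun i => i.elim0⟩
  | succ k ih =>
    push_cast at hk
    obtain ⟨cw, D, hD, hT, he⟩ := ih (by linarith)
    set U := Finset.univ.biUnion D with hU
    have hrU : γ * ∑ y ∈ U, r y ≤ k := by
      rw [hU, Finset.sum_biUnion fun i _ j _ hij => hD hij, Finset.mul_sum]
      calc ∑ i, γ * ∑ y ∈ D i, r y ≤ ∑ _i : Fin k, (1 : ℝ) := by
            refine Finset.sum_le_sum fun i _ => ?_
            rw [Finset.mul_sum, ← hW1 (cw i)]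
            exact (Finset.sum_le_sum (hT i)).trans
              (Finset.sum_le_sum_of_subset_of_nonneg (Finset.subset_univ _) fun y _ _ => hW0 _ _)
        _ = k := by simp
    obtain ⟨x, hx⟩ : ∃ x, 1 - η ≤ ∑ y ∈ Finset.univ.filter (fun y => ¬ W x y < γ * r y) \ U,
        W x y := by
      by_contra! hcon
      have h1 : ∀ x, P x * ∑ y, W x y ≤ P x * ∑ y with W x y < γ * r y, W x y +
          P x * (1 - η) + ∑ y ∈ U, P x * W x y := by
        intro x
        rw [← Finset.mul_sum, ← mul_add, ← mul_add]
        refine mul_le_mul_of_nonneg_left ?_ (hP0 x)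
        rw [← Finset.sum_filter_add_sum_filter_not _ (fun y => W x y < γ * r y), add_assoc]
        refine add_le_add le_rfl ?_
        have h2 : ∑ y with ¬ W x y < γ * r y, W x y ≤
            ∑ y ∈ Finset.univ.filter (fun y => ¬ W x y < γ * r y) \ U ∪ U, W x y :=
          Finset.sum_le_sum_of_subset_of_nonneg (by intro y; simp; tauto) fun y _ _ => hW0 _ _
        rw [Finset.sum_union Finset.sdiff_disjoint] at h2
        have h3 := hcon x
        simp only [not_lt] at h2 h3 ⊢
        linarith
      have h3 := Finset.sum_le_sum fun x (_ : x ∈ Finset.univ) => h1 x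
      simp only [hW1, mul_one, hP1, Finset.sum_add_distrib, ← Finset.sum_mul, one_mul] at h3
      rw [Finset.sum_comm] at h3
      simp only [hr] at h3
      have h4 := mul_le_mul_of_nonneg_left (show η - κ ≤ ∑ y ∈ U, r y by linarith) hγ.le
      linarith
    refine ⟨Fin.cons x cw, Fin.cons (Finset.univ.filter (fun y => ¬ W x y < γ * r y) \ U) D,
      ?_, ?_, ?_⟩
    · have hdis : ∀ i, Disjoint (Finset.univ.filter (fun y => ¬ W x y < γ * r y) \ U) (D i) :=
        fun i => Finset.disjoint_of_subset_right
          (Finset.subset_biUnion_of_mem D (Finset.mem_univ i)) Finset.sdiff_disjoint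
      intro i j hij
      refine Fin.cases ?_ (fun i => ?_) i j hij <;> intro j <;>
        refine Fin.cases (fun hij => ?_) (fun j hij => ?_) j
      · exact absurd rfl hij
      · simpa using hdis j
      · simpa using (hdis i).symm
      · simpa using hD fun h => hij (by rw [h])
    · refine Fin.cases ?_ fun i => ?_
      · intro y hy
        simp only [Fin.cons_zero, Finset.mem_sdiff, Finset.mem_filter, not_lt] at hy ⊢
        exact hy.1.2
      · simpa using hT i
    · exact Fin.cases (by simpa using hx) fun i => by simpa using he i

lemma sum_pi_prod_pow {X Y : Type*} [Fintype X] [Fintype Y] (g : X → Y → ℝ) (n : ℕ) :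
    ∑ x : Fin n → X, ∑ y : Fin n → Y, ∏ i, g (x i) (y i) = (∑ x, ∑ y, g x y) ^ n := by
  classical
  rw [← Fintype.sum_prod_type' (f := g), Fintype.sum_pow,
    ← Fintype.sum_prod_type' (f := fun (x : Fin n → X) (y : Fin n → Y) => ∏ i, g (x i) (y i))]
  exact (Equiv.sum_comp (Equiv.arrowProdEquivProdArrow (Fin n) (fun _ => X) (fun _ => Y))
    fun z => ∏ i, g (z.1 i) (z.2 i)).symm

variable {X Y : Type*} [Fintype X] [Fintype Y] (q : X → PMF Y)

/-- The information density of a block is unlikely to fall short of its mean by a linear amount.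
This is Chernoff's bound: the moment generating function of the shortfall has a negative derivative
at zero. -/
lemma exists_infoDensity_tail (p : PMF X) {δ : ℝ} (hδ : 0 < δ) :
    ∃ ρ : ℝ, 0 ≤ ρ ∧ ρ < 1 ∧ ∀ n : ℕ,
      ∑ x : Fin n → X, (∏ i, (p (x i)).toReal) *
        ∑ y : Fin n → Y with ∏ i, (q (x i) (y i)).toReal <
            Real.exp (n * (mutualInfo q p - δ)) * ∏ i, (p.bind q (y i)).toReal,
          ∏ i, (q (x i) (y i)).toReal ≤ ρ ^ n := by
  classical
  set C := mutualInfo q p with hC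
  set u : Y → ℝ := fun y => (p.bind q y).toReal with hu
  set d : X → Y → ℝ := fun x y => Real.log ((q x y).toReal / u y) - C + δ with hd
  set f : ℝ → ℝ := fun l => ∑ x, ∑ y, (p x).toReal * (q x y).toReal * Real.exp (-l * d x y)
    with hf
  have hmass : ∑ x, ∑ y, (p x).toReal * (q x y).toReal = 1 := by
    simp only [← Finset.mul_sum, sum_toReal_eq_one, mul_one]
  have hf0 : f 0 = 1 := by simpa [hf] using hmass
  have hderiv : HasDerivAt f (-δ) 0 := by
    have h : HasDerivAt f (∑ x, ∑ y, (p x).toReal * (q x y).toReal *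
        (Real.exp (-0 * d x y) * (-1 * d x y))) 0 := by
      refine HasDerivAt.fun_sum fun x _ => HasDerivAt.fun_sum fun y _ => ?_
      exact (((hasDerivAt_id (0 : ℝ)).neg.mul_const _).exp).const_mul _
    convert h using 1
    have h1 : ∀ x y, (p x).toReal * (q x y).toReal * (Real.exp (-0 * d x y) * (-1 * d x y)) =
        (C - δ) * ((p x).toReal * (q x y).toReal) -
          (p x).toReal * (q x y).toReal * Real.log ((q x y).toReal / u y) := by
      intro x y; simp [hd]; ring
    simp only [h1, Finset.sum_sub_distrib, ← Finset.mul_sum]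
    have h2 : mutualInfo q p = ∑ x, ∑ y, (p x).toReal * (q x y).toReal *
      Real.log ((q x y).toReal / u y) := mutualInfo_eq q p
    simp only [mul_assoc, ← Finset.mul_sum] at h2
    simp only [mul_assoc, ← Finset.mul_sum, sum_toReal_eq_one, mul_one, ← h2]
    rw [← hC]; ring
  obtain ⟨l, hl0, hl1⟩ : ∃ l > 0, f l < 1 := by
    have := hderiv.tendsto_slope_zero_right
    have h2 := (this.eventually (gt_mem_nhds (show -δ < 0 by linarith))).and
      self_mem_nhdsWithin
    obtain ⟨l, hl, hlpos⟩ := h2.exists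
    refine ⟨l, hlpos, ?_⟩
    rw [zero_add, hf0, smul_eq_mul] at hl
    have hlpos' : 0 < l := hlpos
    have := (mul_neg_iff.1 hl).resolve_right (by
      rintro ⟨h, -⟩; exact absurd (inv_pos.2 hlpos') (not_lt.2 h.le))
    linarith [this.2]
  refine ⟨f l, Finset.sum_nonneg fun x _ => Finset.sum_nonneg fun y _ => by positivity, hl1,
    fun n => ?_⟩
  rw [hf, ← sum_pi_prod_pow]
  refine Finset.sum_le_sum fun x _ => ?_
  rw [Finset.mul_sum]
  refine (Finset.sum_le_sum fun y hy => ?_).trans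
    (Finset.sum_le_sum_of_subset_of_nonneg (Finset.filter_subset _ _) fun y _ _ =>
      Finset.prod_nonneg fun i _ => by positivity)
  rw [Finset.prod_mul_distrib, Finset.prod_mul_distrib, ← Real.exp_sum]
  by_cases h0 : (∏ i, (p (x i)).toReal) * ∏ i, (q (x i) (y i)).toReal = 0
  · rw [h0, zero_mul]
  refine le_mul_of_one_le_right
    (mul_nonneg (Finset.prod_nonneg fun i _ => by positivity)
      (Finset.prod_nonneg fun i _ => by positivity)) (Real.one_le_exp ?_)
  have hp : ∀ i, (p (x i)).toReal ≠ 0 := fun i =>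
    Finset.prod_ne_zero_iff.1 (left_ne_zero_of_mul h0) i (Finset.mem_univ i)
  have hq : ∀ i, 0 < (q (x i) (y i)).toReal := fun i =>
    lt_of_le_of_ne ENNReal.toReal_nonneg
      (Finset.prod_ne_zero_iff.1 (right_ne_zero_of_mul h0) i (Finset.mem_univ i)).symm
  have hupos : ∀ i, 0 < u (y i) := fun i => by
    simp only [hu, bind_toReal]
    exact Finset.sum_pos' (fun _ _ => by positivity) ⟨x i, Finset.mem_univ _,
      mul_pos (lt_of_le_of_ne ENNReal.toReal_nonneg (hp i).symm) (hq i)⟩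
  have hlt := Real.log_lt_log (Finset.prod_pos fun i _ => hq i) (Finset.mem_filter.1 hy).2
  rw [Real.log_mul (Real.exp_pos _).ne' (Finset.prod_pos fun i _ => hupos i).ne', Real.log_exp,
    Real.log_prod fun i _ => (hq i).ne', Real.log_prod fun i _ => (hupos i).ne'] at hlt
  have hsum : ∑ i, d (x i) (y i) =
      ∑ i, Real.log (q (x i) (y i)).toReal - ∑ i, Real.log (u (y i)) - n * (C - δ) := by
    simp only [hd, fun i => Real.log_div (hq i).ne' (hupos i).ne', Finset.sum_add_distrib,
      Finset.sum_sub_distrib, Finset.sum_const, Finset.card_univ, Fintype.card_fin, nsmul_eq_mul]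
    ring
  rw [← Finset.mul_sum, hsum]
  exact mul_nonneg_of_nonpos_of_nonpos (by linarith) (by linarith)

/-- Codes of all large block lengths with maximal error probability at most `η` and rate at least
`R`, for every `R` below the capacity. -/
theorem exists_block_code [Nonempty X] {R : ℝ} (hR0 : 0 ≤ R) (hR : R < shannonCapacity q)
    {η : ℝ} (hη : 0 < η) :
    ∃ n₀ : ℕ, ∀ n ≥ n₀, ∃ B : ℕ, 2 ≤ B ∧ n * R ≤ Real.log B ∧
      ∃ (cw : Fin B → Fin n → X) (dec : (Fin n → Y) → Fin B), ∀ z,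
        ∑ y, (∏ i, q (cw z i) (y i)) * (if dec y = z then 0 else 1) ≤ ENNReal.ofReal η := by
  classical
  obtain ⟨⟨p, hp⟩, -⟩ := isGreatest_shannonCapacity q
  set C := shannonCapacity q
  set δ := (C - R) / 2 with hδ
  have hδ0 : 0 < δ := by linarith
  obtain ⟨ρ, hρ0, hρ1, htail⟩ := exists_infoDensity_tail q p hδ0
  rw [hp] at htail
  have h1 : ∀ᶠ n : ℕ in atTop, ρ ^ n ≤ η / 2 :=
    ((tendsto_pow_atTop_nhds_zero_of_lt_one hρ0 hρ1).eventually (ge_mem_nhds (by positivity)))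
  have h2 : ∀ᶠ n : ℕ in atTop, 6 / η ≤ Real.exp (n * δ) :=
    (Real.tendsto_exp_atTop.comp
      (tendsto_natCast_atTop_atTop.atTop_mul_const hδ0)).eventually_ge_atTop _
  obtain ⟨n₀, hn₀⟩ := eventually_atTop.1 (h1.and h2)
  refine ⟨n₀, fun n hn => ?_⟩
  obtain ⟨hρn, hexp⟩ := hn₀ n hn
  set γ := Real.exp (n * (C - δ)) with hγ
  have hγ0 : 0 < γ := Real.exp_pos _
  have hγR : 3 * Real.exp (n * R) ≤ γ * (η / 2) := by
    have : γ = Real.exp (n * R) * Real.exp (n * δ) := by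
      rw [hγ, ← Real.exp_add]; congr 1; rw [hδ]; ring
    have h3 : 3 ≤ Real.exp (n * δ) * (η / 2) := by
      have := mul_le_mul_of_nonneg_right hexp (by positivity : 0 ≤ η / 2)
      calc (3 : ℝ) = 6 / η * (η / 2) := by field_simp; norm_num
        _ ≤ _ := this
    rw [this, mul_assoc, mul_comm]
    exact mul_le_mul_of_nonneg_left h3 (Real.exp_pos _).le
  set B := ⌊γ * (η / 2)⌋₊
  have hB1 : (B : ℝ) ≤ γ * (η / 2) := Nat.floor_le (by positivity)
  have hB2 : 2 * Real.exp (n * R) ≤ B := by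
    have := Nat.lt_floor_add_one (γ * (η / 2))
    have h1R : 1 ≤ Real.exp (n * R) := Real.one_le_exp (by positivity)
    linarith
  have hexp1 : 1 ≤ Real.exp (n * R) := Real.one_le_exp (by positivity)
  have hB : 2 ≤ B := by
    have : (2 : ℝ) ≤ B := by linarith
    exact_mod_cast this
  have hrow : ∀ x : Fin n → X, ∑ y : Fin n → Y, ∏ i, (q (x i) (y i)).toReal = 1 := by
    intro x
    rw [← Fintype.prod_sum (fun i y => (q (x i) y).toReal)]
    simp only [sum_toReal_eq_one, Finset.prod_const_one]
  obtain ⟨cw, D, hD, -, he⟩ := exists_feinstein_code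
    (P := fun x : Fin n → X => ∏ i, (p (x i)).toReal)
    (W := fun x (y : Fin n → Y) => ∏ i, (q (x i) (y i)).toReal)
    (r := fun y : Fin n → Y => ∏ i, (p.bind q (y i)).toReal)
    (fun x => Finset.prod_nonneg fun i _ => ENNReal.toReal_nonneg)
    (by rw [← Fintype.prod_sum (fun _ x => (p x).toReal)]
        simp only [sum_toReal_eq_one, Finset.prod_const_one])
    (fun x y => Finset.prod_nonneg fun i _ => ENNReal.toReal_nonneg) hrow
    (fun y => by
      simp only [bind_toReal, Fintype.prod_sum, Finset.prod_mul_distrib])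
    hγ0 (htail n) B (η := η)
    (hB1.trans (mul_le_mul_of_nonneg_left (by linarith) hγ0.le))
  have : Nonempty (Fin B) := ⟨⟨0, by omega⟩⟩
  refine ⟨B, hB, ?_, cw, fun y => if h : ∃ i, y ∈ D i then h.choose else Classical.arbitrary _,
    fun z => ?_⟩
  · rw [Real.le_log_iff_exp_le (by linarith)]
    linarith
  · have hdec : ∀ y ∈ D z, (if h : ∃ i, y ∈ D i then h.choose else Classical.arbitrary _) = z := by
      intro y hy
      have h : ∃ i, y ∈ D i := ⟨z, hy⟩
      rw [dif_pos h]
      by_contra hne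
      exact Finset.disjoint_left.1 (hD hne) h.choose_spec hy
    calc _ ≤ ∑ y : Fin n → Y, ENNReal.ofReal (∏ i, (q (cw z i) (y i)).toReal) *
          (if y ∈ D z then 0 else 1) := by
          refine Finset.sum_le_sum fun y _ => ?_
          rw [ENNReal.ofReal_prod_of_nonneg fun _ _ => ENNReal.toReal_nonneg]
          simp only [ENNReal.ofReal_toReal ((q _).apply_ne_top _)]
          gcongr
          by_cases hy : y ∈ D z
          · rw [if_pos (hdec y hy)]; exact zero_le
          · rw [if_neg hy]; split_ifs <;> simp
      _ = ENNReal.ofReal (∑ y ∈ (D z)ᶜ, ∏ i, (q (cw z i) (y i)).toReal) := by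
          rw [ENNReal.ofReal_sum_of_nonneg
            fun y _ => Finset.prod_nonneg fun _ _ => ENNReal.toReal_nonneg]
          simp only [mul_ite, mul_zero, mul_one]
          rw [← Finset.sum_filter_add_sum_filter_not Finset.univ (fun y => y ∈ D z),
            Finset.sum_eq_zero fun y hy => if_pos (Finset.mem_filter.1 hy).2, zero_add]
          refine Finset.sum_congr (by ext y; simp) fun y hy => if_neg (by simpa using hy)
      _ ≤ ENNReal.ofReal η := by
          refine ENNReal.ofReal_le_ofReal ?_
          have := Finset.sum_add_sum_compl (D z) fun y => ∏ i, (q (cw z i) (y i)).toReal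
          rw [hrow] at this
          linarith [he z]

end Coding

/-! ### The converse of the coding theorem -/

section Converse

open Filter Topology

variable {X Y : Type*} {M : ℕ}

/-- The attack in which the Byzantine sensors in `R` follow the code as if the message were `π w`
instead of `w`, and the other Byzantine sensors are honest. -/
def impersonation (c : Code X Y M) (π : Fin M → Fin M) (R : Set ℕ) : Attack X Y M := by
  classical
  exact
  { send := fun _ w h k a => c.encode k (if k ∈ R then π w else w) (sensorView k h) a
    measurable_send := fun _ _ _ _ _ => measurable_const }

/-- The Byzantine sensors follow the code. -/
abbrev noAttack (c : Code X Y M) : Attack X Y M := impersonation c id ∅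

variable (q : X → PMF Y) (c : Code X Y M) (S : Set ℕ) (w : Fin M)

lemma mean_step_noAttack (h : History X Y) (f : State X Y M → ℝ≥0∞) :
    mean (step q c (noAttack c) S w (h, none)) f =
      mean (c.poll (fusionView h)) fun ka =>
        mean (c.encode ka.1 w (sensorView ka.1 h) ka.2) fun x =>
          mean (q x) fun y =>
            mean (c.decide (fusionView (⟨ka.1, ka.2, x, y⟩ :: h))) fun d =>
              f (⟨ka.1, ka.2, x, y⟩ :: h, d) := by
  simp only [mean_step, noAttack, impersonation, Set.mem_empty_iff_false, if_false, ite_self]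

lemma run_noAttack (n : ℕ) : run q c (noAttack c) S w n = run q c (noAttack c) ∅ w n := by
  have hstep : step q c (noAttack c) S w = step q c (noAttack c) ∅ w := by
    funext s
    rcases s with ⟨h, _ | v⟩ <;>
      simp only [step, noAttack, impersonation, Set.mem_empty_iff_false, if_false, ite_self]
  induction n with
  | zero => rfl
  | succ n ih => simp only [run, ih, hstep]

section Monotone

variable (A : Attack X Y M)

lemma decisionProb_some_mono (v : Fin M) :
    Monotone fun n => decisionProb q c A S w n (some v) := by
  refine monotone_nat_of_le_succ fun n => ?_
  rw [decisionProb_eq_mean, decisionProb_eq_mean, mean_run_succ]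
  refine mean_mono _ fun s _ => ?_
  rcases s with ⟨h, _ | v'⟩
  · simp
  · rw [mean_step_stopped]

lemma tendsto_correctProb : Tendsto (fun n => (decisionProb q c A S w n (some w)).toReal) atTop
    (𝓝 (correctProb q c A S w).toReal) :=
  (ENNReal.tendsto_toReal ((correctProb_le_one ..).trans_lt ENNReal.one_lt_top).ne).comp
    (tendsto_atTop_iSup (decisionProb_some_mono q c S w A w))

/-- The expected number of symbols sent in the first `n` time slots. -/
lemma mean_length (n : ℕ) : mean (run q c A S w n) (fun s => (s.1.length : ℝ≥0∞)) =
    ∑ k ∈ Finset.range n, decisionProb q c A S w k none := by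
  induction n with
  | zero => simp [mean_run_zero]
  | succ n ih =>
    rw [mean_run_succ, Finset.sum_range_succ, ← ih, decisionProb_eq_mean, ← mean_add]
    refine mean_congr _ fun s _ => ?_
    rcases s with ⟨h, _ | v'⟩
    · simp [mean_step, mean_const]
    · simp [mean_step_stopped]

end Monotone

/-- The process observed by the fusion center when the channel output is replaced by noise with
distribution `r`, independent of everything else: one time slot. It does not involve the message. -/
def refStep (r : PMF Y) :
    List (ℕ × ℕ × Y) × Option (Fin M) → PMF (List (ℕ × ℕ × Y) × Option (Fin M))
  | (l, some v) => PMF.pure (l, some v)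
  | (l, none) => (c.poll l).bind fun ka => r.bind fun y =>
      (c.decide ((ka.1, ka.2, y) :: l)).map fun d => ((ka.1, ka.2, y) :: l, d)

/-- The law of the process with steps `refStep` after `n` time slots. -/
def refRun (r : PMF Y) : ℕ → PMF (List (ℕ × ℕ × Y) × Option (Fin M))
  | 0 => PMF.pure ([], none)
  | n + 1 => (refRun r n).bind (refStep c r)

/-- The log-likelihood ratio of the received symbols between the channel `q` and noise with
distribution `r`. -/
def infoDensity (r : PMF Y) (h : History X Y) : ℝ :=
  (h.map fun t => Real.log ((q t.sent t.received).toReal / (r t.received).toReal)).sum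

variable [Fintype Y]

/-- Change of measure: weighting the sessions with `exp (-infoDensity)` turns the channel output
into noise. -/
lemma mean_run_exp_neg_infoDensity_le (r : PMF Y) (hr : ∀ x y, q x y ≠ 0 → r y ≠ 0) (n : ℕ)
    (g : List (ℕ × ℕ × Y) × Option (Fin M) → ℝ≥0∞) :
    mean (run q c (noAttack c) S w n) (fun s =>
      ENNReal.ofReal (Real.exp (-infoDensity q r s.1)) * g (fusionView s.1, s.2)) ≤
      mean (refRun c r n) g := by
  induction n generalizing g with
  | zero => simp [mean_run_zero, refRun, mean_pure, infoDensity, fusionView]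
  | succ n ih =>
    rw [mean_run_succ]
    refine le_trans (mean_mono _ fun s _ => ?_) ((ih fun v => mean (refStep c r v) g).trans
      (mean_bind _ _ _).ge)
    rcases s with ⟨h, _ | v⟩
    · rw [mean_step_noAttack]
      simp only [refStep, mean_bind, mean_map]
      rw [← mean_mul_left]
      refine mean_mono _ fun ka _ => ?_
      refine le_trans (mean_mono _ fun x _ => ?_) (mean_const _ _).le
      have hexp : ∀ y, ENNReal.ofReal (Real.exp (-infoDensity q r (⟨ka.1, ka.2, x, y⟩ :: h))) =
          ENNReal.ofReal (Real.exp (-infoDensity q r h)) *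
          ENNReal.ofReal (Real.exp (-Real.log ((q x y).toReal / (r y).toReal))) := by
        intro y
        rw [← ENNReal.ofReal_mul (Real.exp_pos _).le, ← Real.exp_add]
        simp only [infoDensity, List.map_cons, List.sum_cons, neg_add_rev]
      simp only [hexp, mul_assoc, mean_mul_left]
      gcongr
      rw [mean_fintype, mean_fintype]
      refine Finset.sum_le_sum fun y _ => ?_
      by_cases hq : q x y = 0
      · simp [hq]
      have hq0 := ENNReal.toReal_pos hq ((q x).apply_ne_top y)
      have hr0 := ENNReal.toReal_pos (hr x y hq) (r.apply_ne_top y)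
      rw [← mul_assoc]
      refine mul_le_mul' (le_of_eq ?_) le_rfl
      rw [← Real.log_inv, inv_div, Real.exp_log (div_pos hr0 hq0), ENNReal.ofReal_div_of_pos hq0,
        ENNReal.ofReal_toReal (r.apply_ne_top y), ENNReal.ofReal_toReal ((q x).apply_ne_top y)]
      exact ENNReal.mul_div_cancel hq ((q x).apply_ne_top y)
    · simp only [mean_step_stopped, refStep, mean_pure, le_refl]

/-- Every transmission contributes at most the capacity `C` to the mean information density. The
constant `b` makes all terms nonnegative. -/
lemma mean_infoDensity_le (r : PMF Y) {C b : ℝ} (hC : ∀ x, ∑ y, (q x y).toReal *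
      Real.log ((q x y).toReal / (r y).toReal) ≤ C)
    (hb : ∀ x y, 0 ≤ Real.log ((q x y).toReal / (r y).toReal) + b) (n : ℕ) :
    mean (run q c (noAttack c) S w n)
      (fun s => ENNReal.ofReal (infoDensity q r s.1 + b * s.1.length)) ≤
      ENNReal.ofReal (C + b) * ∑ k ∈ Finset.range n, decisionProb q c (noAttack c) S w k none := by
  induction n with
  | zero => simp [mean_run_zero, infoDensity]
  | succ n ih =>
    rw [mean_run_succ, Finset.sum_range_succ, mul_add]
    refine le_trans ?_ (add_le_add ih le_rfl)
    rw [decisionProb_eq_mean, ← mean_mul_left, ← mean_add]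
    refine mean_mono _ fun s _ => ?_
    rcases s with ⟨h, _ | v⟩
    · rw [mean_step_noAttack, if_pos rfl, mul_one]
      refine le_trans (mean_mono _ fun ka _ => ?_) (mean_const _ _).le
      refine le_trans (mean_mono _ fun x _ => ?_) (mean_const _ _).le
      have hle : ∀ y, ENNReal.ofReal (infoDensity q r (⟨ka.1, ka.2, x, y⟩ :: h) +
          b * ((⟨ka.1, ka.2, x, y⟩ :: h : History X Y).length : ℝ)) ≤
          ENNReal.ofReal (infoDensity q r h + b * h.length) +
          ENNReal.ofReal (Real.log ((q x y).toReal / (r y).toReal) + b) := by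
        intro y
        refine le_trans (ENNReal.ofReal_le_ofReal (le_of_eq ?_)) ENNReal.ofReal_add_le
        simp only [infoDensity, List.map_cons, List.sum_cons, List.length_cons]
        push_cast
        ring
      simp only [mean_const]
      refine (mean_mono _ fun y _ => hle y).trans ?_
      rw [mean_add, mean_const, mean_fintype]
      gcongr
      calc ∑ y, q x y * ENNReal.ofReal (Real.log ((q x y).toReal / (r y).toReal) + b)
          = ∑ y, ENNReal.ofReal ((q x y).toReal *
              (Real.log ((q x y).toReal / (r y).toReal) + b)) := by
            refine Finset.sum_congr rfl fun y _ => ?_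
            rw [ENNReal.ofReal_mul ENNReal.toReal_nonneg,
              ENNReal.ofReal_toReal ((q x).apply_ne_top y)]
        _ = ENNReal.ofReal (∑ y, (q x y).toReal *
              (Real.log ((q x y).toReal / (r y).toReal) + b)) :=
            (ENNReal.ofReal_sum_of_nonneg fun y _ =>
              mul_nonneg ENNReal.toReal_nonneg (hb x y)).symm
        _ ≤ ENNReal.ofReal (C + b) := by
            refine ENNReal.ofReal_le_ofReal ?_
            simp only [mul_add, Finset.sum_add_distrib, ← Finset.sum_mul, sum_toReal_eq_one,
              one_mul]
            linarith [hC x]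
    · simp [mean_step_stopped]

variable [Fintype X] [Nonempty X]

/-- A form of Fano's inequality for the first `n` time slots, summed over all messages. It is the
average of `1 + u ≤ exp u` for `u = log (M s) 1{correct} - infoDensity - log (1 + s)`. The average
of the right-hand side is at most `1`, since after the change of measure the decision is independent
of the message. -/
lemma log_mul_sum_decisionProb_le (hM : 0 < M) {s : ℝ} (hs : 1 ≤ s) (n : ℕ) :
    Real.log (M * s) * ∑ w, (decisionProb q c (noAttack c) S w n (some w)).toReal ≤
      shannonCapacity q * ∑ w, ∑ k ∈ Finset.range n,
        (decisionProb q c (noAttack c) S w k none).toReal + M * Real.log (1 + s) := by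
  classical
  obtain ⟨p, -, hsupp, hC⟩ := exists_capacity_achieving q
  set C := shannonCapacity q
  set r := p.bind q
  set b : ℝ := ∑ x, ∑ y, |Real.log ((q x y).toReal / (r y).toReal)| with hbdef
  have hb : ∀ x y, 0 ≤ Real.log ((q x y).toReal / (r y).toReal) + b := by
    intro x y
    have h1 : |Real.log ((q x y).toReal / (r y).toReal)| ≤ b :=
      (Finset.single_le_sum (f := fun y => |Real.log ((q x y).toReal / (r y).toReal)|)
        (fun _ _ => abs_nonneg _) (Finset.mem_univ y)).trans
      (Finset.single_le_sum (f := fun x => ∑ y, |Real.log ((q x y).toReal / (r y).toReal)|)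
        (fun _ _ => Finset.sum_nonneg fun _ _ => abs_nonneg _) (Finset.mem_univ x))
    linarith [neg_abs_le (Real.log ((q x y).toReal / (r y).toReal))]
  have hb0 : 0 ≤ b := Finset.sum_nonneg fun _ _ => Finset.sum_nonneg fun _ _ => abs_nonneg _
  have hM1 : (1 : ℝ) ≤ M := by exact_mod_cast hM
  have hMs : 1 ≤ M * s := one_le_mul_of_one_le_of_one_le hM1 hs
  set l := Real.log (M * s) with hl
  have hl0 : 0 ≤ l := Real.log_nonneg hMs
  set κ := Real.log (1 + s) with hκ
  have hκ0 : 0 ≤ κ := Real.log_nonneg (by linarith)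
  set g : Fin M → List (ℕ × ℕ × Y) × Option (Fin M) → ℝ≥0∞ := fun w v =>
    ENNReal.ofReal (Real.exp ((if v.2 = some w then l else 0) - κ)) with hg
  set P : Fin M → ℝ≥0∞ := fun w => decisionProb q c (noAttack c) S w n (some w) with hP
  set T : Fin M → ℝ≥0∞ := fun w =>
    ∑ k ∈ Finset.range n, decisionProb q c (noAttack c) S w k none with hT
  have hPtop : ∀ w, P w ≠ ⊤ := fun w => ((decisionProb_le_one ..).trans_lt ENNReal.one_lt_top).ne
  have hTtop : ∀ w, T w ≠ ⊤ := fun w => (ENNReal.sum_lt_top.2 fun k _ =>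
    (decisionProb_le_one ..).trans_lt ENNReal.one_lt_top).ne
  have key : ∀ w, 1 + ENNReal.ofReal l * P w + ENNReal.ofReal b * T w ≤
      mean (refRun c r n) (g w) + ENNReal.ofReal (C + b) * T w + ENNReal.ofReal κ := by
    intro w
    calc 1 + ENNReal.ofReal l * P w + ENNReal.ofReal b * T w
        = mean (run q c (noAttack c) S w n) (fun t =>
            1 + ENNReal.ofReal l * (if t.2 = some w then 1 else 0) +
              ENNReal.ofReal b * t.1.length) := by
          rw [mean_add, mean_add, mean_const, mean_mul_left, mean_mul_left, mean_length,
            ← decisionProb_eq_mean]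
      _ ≤ mean (run q c (noAttack c) S w n) (fun t =>
            ENNReal.ofReal (Real.exp (-infoDensity q r t.1)) * g w (fusionView t.1, t.2) +
            ENNReal.ofReal (infoDensity q r t.1 + b * t.1.length) + ENNReal.ofReal κ) := by
          refine mean_mono _ fun t _ => ?_
          set f : ℝ := if t.2 = some w then l else 0 with hf
          have hf0 : 0 ≤ f := by rw [hf]; split_ifs <;> simp [hl0]
          have h1 : (ENNReal.ofReal l * (if t.2 = some w then 1 else 0) : ℝ≥0∞) =
              ENNReal.ofReal f := by
            rw [hf]; split_ifs <;> simp
          rw [h1, hg, ← ENNReal.ofReal_mul (Real.exp_pos _).le, ← Real.exp_add,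
            ← ENNReal.ofReal_one, ← ENNReal.ofReal_natCast t.1.length, ← ENNReal.ofReal_mul hb0,
            ← ENNReal.ofReal_add zero_le_one hf0, ← ENNReal.ofReal_add (by linarith)
              (by positivity)]
          refine le_trans (ENNReal.ofReal_le_ofReal ?_) (ENNReal.ofReal_add_le.trans
            (add_le_add ENNReal.ofReal_add_le le_rfl))
          linarith [Real.add_one_le_exp (-infoDensity q r t.1 + (f - κ))]
      _ ≤ _ := by
          rw [mean_add, mean_add, mean_const]
          gcongr
          · exact mean_run_exp_neg_infoDensity_le q c S w r hsupp n (g w)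
          · exact mean_infoDensity_le q c S w r hC hb n
  have hgsum : ∑ w, mean (refRun c r n) (g w) ≤ M := by
    rw [← mean_sum]
    refine (mean_mono _ fun v _ => ?_).trans (mean_const _ _).le
    rw [← ENNReal.ofReal_sum_of_nonneg fun _ _ => (Real.exp_pos _).le, ← ENNReal.ofReal_natCast]
    refine ENNReal.ofReal_le_ofReal ?_
    have h1 : ∀ w, Real.exp ((if v.2 = some w then l else 0) - κ) ≤
        (1 + if v.2 = some w then (M : ℝ) * s else 0) / (1 + s) := by
      intro w
      rw [Real.exp_sub, hκ, Real.exp_log (by linarith)]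
      gcongr
      split_ifs
      · rw [hl, Real.exp_log (by linarith)]; linarith
      · simp
    have h2 : ∑ w : Fin M, (if v.2 = some w then (M : ℝ) * s else 0) ≤ M * s := by
      rcases v.2 with _ | w
      · simpa using (by linarith : (0 : ℝ) ≤ M * s)
      · simp
    calc _ ≤ _ := Finset.sum_le_sum fun w _ => h1 w
      _ ≤ (M + M * s) / (1 + s) := by
        rw [← Finset.sum_div, Finset.sum_add_distrib]
        gcongr
        simp
      _ = M := by field_simp
  have hsum := Finset.sum_le_sum fun w (_ : w ∈ Finset.univ) => key w
  simp only [Finset.sum_add_distrib, ← Finset.mul_sum, Finset.sum_const, Finset.card_univ,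
    Fintype.card_fin, nsmul_eq_mul, mul_one] at hsum
  have hsum' := hsum.trans (add_le_add (add_le_add hgsum le_rfl) le_rfl)
  have hCb : 0 ≤ C + b := by
    have x := Classical.arbitrary X
    have h1 := hC x
    have h2 : 0 ≤ ∑ y, (q x y).toReal * (Real.log ((q x y).toReal / (r y).toReal) + b) :=
      Finset.sum_nonneg fun y _ => mul_nonneg ENNReal.toReal_nonneg (hb x y)
    simp only [mul_add, Finset.sum_add_distrib, ← Finset.sum_mul, sum_toReal_eq_one,
      one_mul] at h2
    linarith
  have hPs : ∑ w, P w ≠ ⊤ := ENNReal.sum_ne_top.2 fun w _ => hPtop w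
  have hTs : ∑ w, T w ≠ ⊤ := ENNReal.sum_ne_top.2 fun w _ => hTtop w
  have hreal := ENNReal.toReal_mono (by finiteness) hsum'
  rw [ENNReal.toReal_add (by finiteness) (by finiteness),
    ENNReal.toReal_add (by finiteness) (by finiteness),
    ENNReal.toReal_add (by finiteness) (by finiteness),
    ENNReal.toReal_add (by finiteness) (by finiteness)] at hreal
  simp only [ENNReal.toReal_mul, ENNReal.toReal_ofReal hl0, ENNReal.toReal_ofReal hb0,
    ENNReal.toReal_ofReal hCb, ENNReal.toReal_ofReal hκ0, ENNReal.toReal_natCast] at hreal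
  rw [ENNReal.toReal_sum fun w _ => hPtop w, ENNReal.toReal_sum fun w _ => hTtop w] at hreal
  have hTk : ∀ w, (T w).toReal = ∑ k ∈ Finset.range n,
      (decisionProb q c (noAttack c) S w k none).toReal := fun w =>
    ENNReal.toReal_sum fun k _ => ((decisionProb_le_one ..).trans_lt ENNReal.one_lt_top).ne
  simp only [hTk] at hreal
  linarith

omit [Fintype Y] [Fintype X] [Nonempty X] in
lemma expectedLengthGiven_ge_one (A : Attack X Y M) : 1 ≤ expectedLengthGiven q c A S w := by
  refine le_trans (le_of_eq ?_) (ENNReal.le_tsum 0)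
  rw [decisionProb_eq_mean, mean_run_zero, if_pos rfl]

lemma shannonCapacity_nonneg : 0 ≤ shannonCapacity q := by
  obtain ⟨p, -, hsupp, hC⟩ := exists_capacity_achieving q
  have x := Classical.arbitrary X
  have h := Finset.sum_le_sum fun y (_ : y ∈ Finset.univ) =>
    sub_le_mul_log_div (a := (q x y).toReal) (b := (p.bind q y).toReal) ENNReal.toReal_nonneg
      ENNReal.toReal_nonneg fun hq => (ENNReal.toReal_pos
        (hsupp x y fun h0 => hq (by simp [h0])) ((p.bind q).apply_ne_top y)).ne'
  rw [Finset.sum_sub_distrib, sum_toReal_eq_one, sum_toReal_eq_one, sub_self] at h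
  exact h.trans (hC x)

lemma log_mul_sum_correctProb_le (hM : 0 < M) {s : ℝ} (hs : 1 ≤ s)
    (hN : ∀ w, expectedLengthGiven q c (noAttack c) S w ≠ ⊤) :
    Real.log (M * s) * ∑ w, (correctProb q c (noAttack c) S w).toReal ≤
      shannonCapacity q * ∑ w, (expectedLengthGiven q c (noAttack c) S w).toReal +
        M * Real.log (1 + s) := by
  refine le_of_tendsto ((tendsto_finsetSum _ fun w _ =>
    tendsto_correctProb q c S w (noAttack c)).const_mul _) (Eventually.of_forall fun n => ?_)
  refine (log_mul_sum_decisionProb_le q c S hM hs n).trans ?_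
  have := shannonCapacity_nonneg q
  gcongr with w
  rw [← ENNReal.toReal_sum fun k _ => ((decisionProb_le_one ..).trans_lt ENNReal.one_lt_top).ne]
  exact ENNReal.toReal_mono (hN w) (ENNReal.sum_le_tsum _)

/-- Even if all Byzantine sensors follow the code, no rate above the Shannon capacity is
achievable, in spite of feedback and variable length. -/
theorem le_shannonCapacity_of_achievable {β : unitInterval} {R : ℝ} (hR : Achievable q β R) :
    R ≤ shannonCapacity q := by
  set C := shannonCapacity q with hC
  have hC0 : 0 ≤ C := shannonCapacity_nonneg q
  have key : ∀ s : ℝ, 1 ≤ s → ∀ ε : ℝ, 0 < ε → ε < 1 →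
      (1 - ε) * (R - ε) ≤ C + Real.log (1 + s⁻¹) + ε * Real.log s := by
    intro s hs ε hε hε1
    have hls : 0 ≤ Real.log s := Real.log_nonneg hs
    have hls' : 0 ≤ Real.log (1 + s⁻¹) := Real.log_nonneg (by
      have : 0 < s⁻¹ := by positivity
      linarith)
    obtain ⟨M, hM, c, hc⟩ := hR ε hε
    obtain ⟨herr, hrate⟩ := hc (noAttack c)
    have hM0 : (0 : ℝ) < M := by exact_mod_cast hM
    have hMtop : (M : ℝ≥0∞) ≠ ⊤ := ENNReal.natCast_ne_top M
    have hMne : (M : ℝ≥0∞) ≠ 0 := by exact_mod_cast hM.ne'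
    have hcorr : ∀ S w, correctProb q c (noAttack c) S w = correctProb q c (noAttack c) ∅ w := by
      intro S w; simp only [correctProb, decisionProb, run_noAttack q c S]
    have hlen : ∀ S w, expectedLengthGiven q c (noAttack c) S w =
        expectedLengthGiven q c (noAttack c) ∅ w := by
      intro S w; simp only [expectedLengthGiven, decisionProb, run_noAttack q c S]
    set a : Fin M → ℝ≥0∞ := fun w => correctProb q c (noAttack c) ∅ w
    set N : Fin M → ℝ≥0∞ := fun w => expectedLengthGiven q c (noAttack c) ∅ w
    have ha1 : ∀ w, a w ≤ 1 := fun w => correctProb_le_one ..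
    have hN1 : ∀ w, 1 ≤ N w := fun w => expectedLengthGiven_ge_one ..
    simp only [errorProb, hcorr, lintegral_const, measure_univ, mul_one] at herr
    simp only [rate, expectedLength, hlen, lintegral_const, measure_univ, mul_one] at hrate
    rcases le_or_gt (R - ε) 0 with hRε | hRε
    · have := mul_nonpos_of_nonneg_of_nonpos (by linarith : 0 ≤ 1 - ε) hRε
      have := mul_nonneg hε.le hls
      linarith
    have hpos := hRε.trans hrate
    change 0 < Real.log M / ((∑ w, N w) / M).toReal at hpos
    change R - ε < Real.log M / ((∑ w, N w) / M).toReal at hrate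
    change (∑ w, (1 - a w)) / M < _ at herr
    have hNtop : ∑ w, N w ≠ ⊤ := by
      intro h
      rw [h, ENNReal.top_div_of_ne_top hMtop] at hpos
      simp at hpos
    have hNw : ∀ w, N w ≠ ⊤ := fun w => ENNReal.sum_ne_top.1 hNtop w (Finset.mem_univ w)
    have hbound := log_mul_sum_correctProb_le q c ∅ hM hs hNw
    change Real.log (M * s) * ∑ w, (a w).toReal ≤ C * ∑ w, (N w).toReal + _ at hbound
    set EN := ((∑ w, N w) / M).toReal with hEN
    have hENsum : ∑ w, (N w).toReal = M * EN := by
      rw [hEN, ENNReal.toReal_div, ENNReal.toReal_natCast, ENNReal.toReal_sum fun w _ => hNw w]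
      field_simp
    have hEN1 : 1 ≤ EN := by
      have : (M : ℝ) ≤ ∑ w, (N w).toReal := by
        calc (M : ℝ) = ∑ _w : Fin M, (1 : ℝ) := by simp
          _ ≤ _ := Finset.sum_le_sum fun w _ => by
            simpa using ENNReal.toReal_mono (hNw w) (hN1 w)
      rw [hENsum] at this
      exact le_of_mul_le_mul_left (by linarith) hM0
    have hasum : (M : ℝ) * (1 - ε) ≤ ∑ w, (a w).toReal := by
      have h1 := (ENNReal.div_le_iff hMne hMtop).1 herr.le
      rw [← ENNReal.ofReal_natCast, ← ENNReal.ofReal_mul hε.le] at h1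
      have h2 := ENNReal.toReal_mono ENNReal.ofReal_ne_top h1
      rw [ENNReal.toReal_ofReal (by positivity), ENNReal.toReal_sum fun w _ =>
        ENNReal.sub_ne_top ENNReal.one_ne_top] at h2
      simp only [ENNReal.toReal_sub_of_le (ha1 _) ENNReal.one_ne_top, ENNReal.toReal_one,
        Finset.sum_sub_distrib, Finset.sum_const, Finset.card_univ, Fintype.card_fin,
        nsmul_eq_mul, mul_one] at h2
      linarith
    have hs0 : (0 : ℝ) < s := by linarith
    have hlogM : 0 ≤ Real.log M := Real.log_nonneg (by exact_mod_cast hM)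
    have hlogMs : Real.log (M * s) = Real.log M + Real.log s := Real.log_mul hM0.ne' hs0.ne'
    have hlog1s : Real.log (1 + s) = Real.log (1 + s⁻¹) + Real.log s := by
      rw [← Real.log_mul (by positivity) hs0.ne']; congr 1; field_simp; ring
    have h3 : (Real.log M + Real.log s) * (1 - ε) ≤ C * EN + (Real.log (1 + s⁻¹) + Real.log s) := by
      have h4 := mul_le_mul_of_nonneg_left hasum (by linarith : 0 ≤ Real.log M + Real.log s)
      rw [hlogMs, hENsum, hlog1s] at hbound
      have h5 : (M : ℝ) * ((Real.log M + Real.log s) * (1 - ε)) ≤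
          M * (C * EN + (Real.log (1 + s⁻¹) + Real.log s)) := by linarith
      exact le_of_mul_le_mul_left h5 hM0
    have h6 : (R - ε) * EN ≤ Real.log M := by
      have := (lt_div_iff₀ (by linarith : 0 < EN)).1 hrate
      linarith
    have h7 : (1 - ε) * (R - ε) * EN ≤ (C + Real.log (1 + s⁻¹) + ε * Real.log s) * EN := by
      have h8 := mul_le_mul_of_nonneg_left h6 (by linarith : 0 ≤ 1 - ε)
      have h9 : Real.log (1 + s⁻¹) + ε * Real.log s ≤
          (Real.log (1 + s⁻¹) + ε * Real.log s) * EN :=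
        le_mul_of_one_le_right (by positivity) hEN1
      linarith
    exact le_of_mul_le_mul_right h7 (by linarith)
  -- First `ε → 0`, then `s → ∞`.
  have key2 : ∀ s : ℝ, 1 ≤ s → R ≤ C + Real.log (1 + s⁻¹) := by
    intro s hs
    have h1 : Tendsto (fun ε : ℝ => (1 - ε) * (R - ε)) (𝓝[>] 0) (𝓝 R) := by
      have : Continuous fun ε : ℝ => (1 - ε) * (R - ε) := by fun_prop
      simpa using (this.tendsto 0).mono_left nhdsWithin_le_nhds
    have h2 : Tendsto (fun ε : ℝ => C + Real.log (1 + s⁻¹) + ε * Real.log s) (𝓝[>] 0)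
        (𝓝 (C + Real.log (1 + s⁻¹))) := by
      have : Continuous fun ε : ℝ => C + Real.log (1 + s⁻¹) + ε * Real.log s := by fun_prop
      simpa using (this.tendsto 0).mono_left nhdsWithin_le_nhds
    refine le_of_tendsto_of_tendsto h1 h2 ?_
    filter_upwards [Ioo_mem_nhdsGT (zero_lt_one' ℝ)] with ε hε using key s hs ε hε.1 hε.2
  have h3 : Tendsto (fun s : ℝ => C + Real.log (1 + s⁻¹)) atTop (𝓝 C) := by
    have := (tendsto_inv_atTop_zero (𝕜 := ℝ)).const_add 1
    simpa using ((this.log (by norm_num))).const_add C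
  exact ge_of_tendsto h3 (by filter_upwards [eventually_ge_atTop 1] with s hs using key2 s hs)

end Converse

/-! ### The random set of Byzantine sensors -/

section SensorSet

lemma measurableSet_subset (F : Finset ℕ) : MeasurableSet {S : Set ℕ | ↑F ⊆ S} := by
  have : {S : Set ℕ | ↑F ⊆ S} = ⋂ k ∈ F, {S : Set ℕ | k ∈ S} := by
    ext S; simp [Set.subset_def]
  rw [this]
  exact Finset.measurableSet_biInter _ fun k _ => measurableSet_mem k

lemma toNNReal_eq_ofReal (p : unitInterval) :
    (unitInterval.toNNReal p : ℝ≥0∞) = ENNReal.ofReal p := by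
  rw [← ENNReal.ofReal_coe_nnreal]
  rfl

lemma setBernoulli_subset (p : unitInterval) (F : Finset ℕ) :
    setBernoulli (Set.univ : Set ℕ) p {S | ↑F ⊆ S} = ENNReal.ofReal p ^ F.card := by
  rw [setBernoulli_apply']
  have : (fun x : ℕ → Prop => {i | x i}) ⁻¹' {S | ↑F ⊆ S} =
      Set.pi F (fun _ => ({True} : Set Prop)) := by
    ext x; simp [Set.subset_def, Set.pi]
  rw [this, Measure.infinitePi_pi _ (fun _ _ => MeasurableSet.of_discrete)]
  simp [toNNReal_eq_ofReal]

/-- The law of a random set is determined by the probabilities of its containing a given finite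
set. -/
lemma eq_setBernoulli {μ : Measure (Set ℕ)} [IsProbabilityMeasure μ] {p : unitInterval}
    (h : ∀ F : Finset ℕ, μ {S | ↑F ⊆ S} = ENNReal.ofReal p ^ F.card) :
    μ = setBernoulli (Set.univ : Set ℕ) p := by
  classical
  refine ext_of_generate_finite (Set.range fun F : Finset ℕ => {S : Set ℕ | ↑F ⊆ S}) ?_ ?_ ?_
    (by simp)
  · refine le_antisymm ?_ (MeasurableSpace.generateFrom_le ?_)
    · refine iSup_le fun k => ?_
      rintro _ ⟨s, -, rfl⟩
      have hk : MeasurableSpace.generateFrom (Set.range fun F : Finset ℕ =>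
          {S : Set ℕ | ↑F ⊆ S}) |>.MeasurableSet' {S : Set ℕ | k ∈ S} :=
        MeasurableSpace.measurableSet_generateFrom ⟨{k}, by simp⟩
      refine @measurable_to_prop _ (MeasurableSpace.generateFrom _) (fun S : Set ℕ => k ∈ S) ?_ s
        trivial
      have : (fun S : Set ℕ => k ∈ S) ⁻¹' {True} = {S : Set ℕ | k ∈ S} := by ext S; simp
      rw [this]
      exact hk
    · rintro _ ⟨F, rfl⟩
      exact measurableSet_subset F
  · rintro _ ⟨F, rfl⟩ _ ⟨G, rfl⟩ -
    refine ⟨F ∪ G, ?_⟩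
    ext S; simp
  · rintro _ ⟨F, rfl⟩
    rw [h, setBernoulli_subset]

/-- Thinning a Bernoulli random set independently with probability `p'` gives a Bernoulli set. -/
lemma map_inter_setBernoulli (p p' : unitInterval) :
    ((setBernoulli (Set.univ : Set ℕ) p).prod (setBernoulli (Set.univ : Set ℕ) p')).map
      (fun z => z.1 ∩ z.2) = setBernoulli (Set.univ : Set ℕ) (p * p') := by
  have hmeas : Measurable fun z : Set ℕ × Set ℕ => z.1 ∩ z.2 := by
    rw [measurable_set_iff]
    intro a
    simp only [Set.mem_inter_iff]
    fun_prop
  have := Measure.isProbabilityMeasure_map (μ := (setBernoulli (Set.univ : Set ℕ) p).prod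
    (setBernoulli (Set.univ : Set ℕ) p')) hmeas.aemeasurable
  refine eq_setBernoulli fun F => ?_
  rw [Measure.map_apply hmeas (measurableSet_subset F)]
  have : (fun z : Set ℕ × Set ℕ => z.1 ∩ z.2) ⁻¹' {S | ↑F ⊆ S} =
      {S : Set ℕ | ↑F ⊆ S} ×ˢ {S : Set ℕ | ↑F ⊆ S} := by
    ext z; simp
  rw [this, Measure.prod_prod, setBernoulli_subset, setBernoulli_subset, ← mul_pow,
    ← ENNReal.ofReal_mul p.2.1]
  rfl

lemma setBernoulli_disjoint (p : unitInterval) (F : Finset ℕ) :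
    setBernoulli (Set.univ : Set ℕ) p {S | ↑F ⊆ Sᶜ} = ENNReal.ofReal (1 - p) ^ F.card := by
  rw [setBernoulli_apply']
  have : (fun x : ℕ → Prop => {i | x i}) ⁻¹' {S | ↑F ⊆ Sᶜ} =
      Set.pi F (fun _ => ({False} : Set Prop)) := by
    ext x; simp [Set.subset_def, Set.pi]
  rw [this, Measure.infinitePi_pi _ (fun _ _ => MeasurableSet.of_discrete)]
  simp [toNNReal_eq_ofReal]

lemma measurable_compl_set : Measurable fun S : Set ℕ => Sᶜ := by
  rw [measurable_set_iff]
  intro a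
  simp only [Set.mem_compl_iff]
  fun_prop

lemma map_compl_setBernoulli (p : unitInterval) :
    (setBernoulli (Set.univ : Set ℕ) p).map (fun S => Sᶜ) =
      setBernoulli (Set.univ : Set ℕ) (unitInterval.symm p) := by
  have := Measure.isProbabilityMeasure_map (μ := setBernoulli (Set.univ : Set ℕ) p)
    measurable_compl_set.aemeasurable
  refine eq_setBernoulli fun F => ?_
  rw [Measure.map_apply measurable_compl_set (measurableSet_subset F)]
  exact setBernoulli_disjoint p F

end SensorSet

/-! ### Symmetrization: a Byzantine majority -/

section Symmetrization

variable {X Y : Type*} {M : ℕ} (q : X → PMF Y) (c : Code X Y M)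

instance [Countable X] [Countable Y] : Countable (Round X Y) :=
  Function.Injective.countable (f := fun t : Round X Y => (t.sensor, t.info, t.sent, t.received))
    fun s t h => by cases s; cases t; simpa using h

section Measurability

variable [Countable X] [Countable Y] (A : Attack X Y M) (w : Fin M)

open scoped Classical in
omit [Countable Y] in
lemma measurable_step (s t : State X Y M) : Measurable fun S => step q c A S w s t := by
  rcases s with ⟨h, _ | v⟩
  · simp only [step, PMF.bind_apply]
    refine Measurable.tsum fun ka => Measurable.const_mul (Measurable.tsum fun x =>
      Measurable.mul_const ?_ _) _
    have hite : (fun S : Set ℕ => (if ka.1 ∈ S then A.send S w h ka.1 ka.2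
        else c.encode ka.1 w (sensorView ka.1 h) ka.2) x) =
        fun S => if ka.1 ∈ S then A.send S w h ka.1 ka.2 x
          else c.encode ka.1 w (sensorView ka.1 h) ka.2 x := by
      funext S; split_ifs <;> rfl
    rw [hite]
    exact Measurable.ite (measurableSet_mem ka.1) (A.measurable_send w h ka.1 ka.2 x)
      measurable_const
  · simp only [step]
    exact measurable_const

lemma measurable_run (n : ℕ) (t : State X Y M) : Measurable fun S => run q c A S w n t := by
  induction n generalizing t with
  | zero => exact measurable_const
  | succ n ih =>
    simp only [run, PMF.bind_apply]
    exact Measurable.tsum fun s => (ih s).mul (measurable_step q c A w s t)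

lemma measurable_correctProb : Measurable fun S => correctProb q c A S w := by
  refine Measurable.iSup fun n => ?_
  simp only [decisionProb_eq_mean, mean]
  exact Measurable.tsum fun s => (measurable_run q c A w n s).mul_const _

end Measurability

lemma correctProb_impersonation_inter (π : Fin M → Fin M) (R S : Set ℕ) (w : Fin M) :
    correctProb q c (impersonation c π R) S w =
      correctProb q c (impersonation c π Set.univ) (S ∩ R) w := by
  have hstep : step q c (impersonation c π R) S w =
      step q c (impersonation c π Set.univ) (S ∩ R) w := by
    funext s
    rcases s with ⟨h, _ | v⟩
    · simp only [step, impersonation, Set.mem_univ, if_true, Set.mem_inter_iff]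
      congr 1
      funext ka
      by_cases h1 : ka.1 ∈ S <;> by_cases h2 : ka.1 ∈ R <;> simp [h1, h2]
    · rfl
  have hrun : ∀ n, run q c (impersonation c π R) S w n =
      run q c (impersonation c π Set.univ) (S ∩ R) w n := by
    intro n
    induction n with
    | zero => rfl
    | succ n ih => simp only [run, ih, hstep]
  simp only [correctProb, decisionProb, hrun]

/-- The session in which the sensors in `S` argue for `π w` and the others for `w` is the same,
whether `S` is the Byzantine set and `w` the message, or `Sᶜ` the Byzantine set and `π w` the
message. -/
lemma run_impersonation_compl (π : Equiv.Perm (Fin M)) (S : Set ℕ) (w : Fin M) (n : ℕ) :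
    run q c (impersonation c π Set.univ) S w n =
      run q c (impersonation c π.symm Set.univ) Sᶜ (π w) n := by
  have hstep : step q c (impersonation c π Set.univ) S w =
      step q c (impersonation c π.symm Set.univ) Sᶜ (π w) := by
    funext s
    rcases s with ⟨h, _ | v⟩
    · simp only [step, impersonation, Set.mem_univ, if_true, Set.mem_compl_iff,
        Equiv.symm_apply_apply]
      congr 1
      funext ka
      by_cases h1 : ka.1 ∈ S <;> simp [h1]
    · rfl
  induction n with
  | zero => rfl
  | succ n ih => simp only [run, ih, hstep]

lemma correctProb_add_correctProb_le_one (π : Equiv.Perm (Fin M)) (S : Set ℕ) (w : Fin M)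
    (hw : π w ≠ w) :
    correctProb q c (impersonation c π Set.univ) S w +
      correctProb q c (impersonation c π.symm Set.univ) Sᶜ (π w) ≤ 1 := by
  rw [correctProb, correctProb, ENNReal.iSup_add_iSup_of_monotone
    (decisionProb_some_mono q c S w _ w) (decisionProb_some_mono q c Sᶜ (π w) _ (π w))]
  refine iSup_le fun n => ?_
  simp only [decisionProb, ← run_impersonation_compl q c π S w n]
  set p := (run q c (impersonation c π Set.univ) S w n).map Prod.snd
  rw [← p.tsum_coe, ← Finset.sum_pair (f := p) (a := some w) (b := some (π w))
    fun h => hw (Option.some.inj h).symm]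
  exact ENNReal.sum_le_tsum _

/-- The probability of error, given that `S` is the set of Byzantine sensors. -/
def errorProbGiven (A : Attack X Y M) (S : Set ℕ) : ℝ≥0∞ := (∑ w, (1 - correctProb q c A S w)) / M

lemma one_le_errorProbGiven_add (hM : 0 < M) (π : Equiv.Perm (Fin M)) (hπ : ∀ w, π w ≠ w)
    (S : Set ℕ) :
    1 ≤ errorProbGiven q c (impersonation c π Set.univ) S +
      errorProbGiven q c (impersonation c π.symm Set.univ) Sᶜ := by
  have hM0 : (M : ℝ≥0∞) ≠ 0 := by exact_mod_cast hM.ne'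
  rw [errorProbGiven, errorProbGiven, ← ENNReal.add_div,
    ENNReal.le_div_iff_mul_le (.inl hM0) (.inl (ENNReal.natCast_ne_top M)), one_mul,
    ← Equiv.sum_comp π fun w => 1 - correctProb q c (impersonation c π.symm Set.univ) Sᶜ w,
    ← Finset.sum_add_distrib]
  calc (M : ℝ≥0∞) = ∑ _w : Fin M, (1 : ℝ≥0∞) := by simp
    _ ≤ _ := Finset.sum_le_sum fun w _ => ?_
  have h1 := correctProb_add_correctProb_le_one q c π S w (hπ w)
  set a := correctProb q c (impersonation c π Set.univ) S w
  set b := correctProb q c (impersonation c π.symm Set.univ) Sᶜ (π w)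
  have ha : b ≤ 1 - a := by
    refine ENNReal.le_sub_of_add_le_left ?_ h1
    exact ((correctProb_le_one ..).trans_lt ENNReal.one_lt_top).ne
  calc 1 = b + (1 - b) := (add_tsub_cancel_of_le (correctProb_le_one ..)).symm
    _ ≤ _ := add_le_add ha le_rfl

/-- If at least half of the sensors are Byzantine on average, then for some `R` the attack in which
the Byzantine sensors in `R` impersonate honest sensors with another message succeeds with
probability at least `1 / 2`, because the thinned set `S ∩ R` has the same law as its complement. -/
lemma exists_impersonation_errorProb [Countable X] [Countable Y] (hM : 0 < M)
    (π : Equiv.Perm (Fin M)) (hπ : ∀ w, π w ≠ w) {β : unitInterval} (hβ : 1 / 2 ≤ (β : ℝ)) :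
    ∃ A : Attack X Y M, 1 / 2 ≤ errorProb q c A β := by
  by_contra! hcon
  set β' : unitInterval := ⟨1 / (2 * β), by positivity, by
    rw [div_le_one (by linarith)]; linarith⟩
  set half : unitInterval := ⟨1 / 2, by norm_num, by norm_num⟩
  have hββ' : β * β' = half := by
    have : (β : ℝ) ≠ 0 := by linarith
    ext; simp only [Set.Icc.coe_mul, β', half]; field_simp
  have hsymm : unitInterval.symm half = half := by
    ext; simp only [unitInterval.coe_symm_eq, half]; norm_num
  set μ := setBernoulli (Set.univ : Set ℕ)
  have hmeas : ∀ A : Attack X Y M, Measurable (errorProbGiven q c A) := fun A =>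
    (Finset.measurable_sum _ fun w _ =>
      (measurable_correctProb q c A w).const_sub 1).div_const _
  have hlt : ∀ π : Fin M → Fin M,
      ∫⁻ S, errorProbGiven q c (impersonation c π Set.univ) S ∂(μ half) < 1 / 2 := by
    intro π
    have hinter : Measurable fun z : Set ℕ × Set ℕ => z.1 ∩ z.2 := by
      rw [measurable_set_iff]
      intro a
      simp only [Set.mem_inter_iff]
      fun_prop
    have hmap : ((μ β').prod (μ β)).map (fun z => z.1 ∩ z.2) = μ half := by
      rw [← hββ', mul_comm]
      exact map_inter_setBernoulli β' β
    rw [← hmap, lintegral_map (hmeas _) hinter, lintegral_prod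
        (fun z => errorProbGiven q c (impersonation c π Set.univ) (z.1 ∩ z.2))
        ((hmeas _).comp hinter).aemeasurable]
    have hR : ∀ R,
        ∫⁻ S, errorProbGiven q c (impersonation c π Set.univ) (R ∩ S) ∂(μ β) < 1 / 2 := by
      intro R
      refine lt_of_eq_of_lt ?_ (hcon (impersonation c π R))
      refine lintegral_congr fun S => ?_
      simp only [errorProbGiven, correctProb_impersonation_inter q c π R, Set.inter_comm]
    have hle : ∫⁻ R, ∫⁻ S, errorProbGiven q c (impersonation c π Set.univ) (R ∩ S) ∂(μ β)
        ∂(μ β') ≤ 1 / 2 :=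
      (lintegral_mono fun R => (hR R).le).trans (by simp [μ])
    refine lt_of_lt_of_le (lintegral_strict_mono (g := fun _ => 1 / 2)
      (IsProbabilityMeasure.ne_zero _) aemeasurable_const
      (hle.trans_lt (by simp)).ne (.of_forall hR)) (by simp)
  have h1 : (1 : ℝ≥0∞) ≤ ∫⁻ S, errorProbGiven q c (impersonation c π Set.univ) S ∂(μ half) +
      ∫⁻ S, errorProbGiven q c (impersonation c π.symm Set.univ) S ∂(μ half) := by
    have hcompl : ∫⁻ S, errorProbGiven q c (impersonation c π.symm Set.univ) S ∂(μ half) =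
        ∫⁻ S, errorProbGiven q c (impersonation c π.symm Set.univ) Sᶜ ∂(μ half) := by
      rw [← lintegral_map (hmeas _) measurable_compl_set, map_compl_setBernoulli, hsymm]
    rw [hcompl, ← lintegral_add_left (hmeas _)]
    calc (1 : ℝ≥0∞) = ∫⁻ _S, 1 ∂(μ half) := by simp [μ]
      _ ≤ _ := lintegral_mono fun S => one_le_errorProbGiven_add q c hM π hπ S
  have h2 := h1.trans_lt (ENNReal.add_lt_add (hlt π) (hlt π.symm))
  rw [ENNReal.add_halves] at h2
  exact lt_irrefl _ h2

theorem le_zero_of_achievable_of_half_le [Countable X] [Countable Y] {β : unitInterval}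
    (hβ : 1 / 2 ≤ (β : ℝ)) {R : ℝ} (hR : Achievable q β R) : R ≤ 0 := by
  by_contra! hpos
  obtain ⟨M, hM, c, hc⟩ := hR (min R (1 / 2)) (by positivity)
  have hM2 : 2 ≤ M := by
    by_contra! hlt
    obtain rfl : M = 1 := by omega
    have h1 := (hc (noAttack c)).2
    simp only [rate, Nat.cast_one, Real.log_one, zero_div] at h1
    linarith [min_le_left R (1 / 2)]
  obtain ⟨n, rfl⟩ : ∃ n, M = n + 2 := ⟨M - 2, by omega⟩
  obtain ⟨A, hA⟩ := exists_impersonation_errorProb q c hM (finRotate (n + 2))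
    (fun w h => by simp at h) hβ
  have h2 := hA.trans_lt (hc A).1
  have h3 : ENNReal.ofReal (min R (1 / 2)) ≤ 1 / 2 := by
    refine (ENNReal.ofReal_le_ofReal (min_le_right _ _)).trans (le_of_eq ?_)
    rw [ENNReal.ofReal_div_of_pos two_pos]; simp
  exact absurd h2 (not_lt.2 h3)

/-- The rate `0` is achieved by a code with a single message. -/
theorem achievable_zero [Nonempty X] (β : unitInterval) : Achievable q β 0 := by
  intro ε hε
  refine ⟨1, one_pos, ⟨fun _ => PMF.pure (0, 0), fun _ _ _ _ => PMF.pure (Classical.arbitrary X),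
    fun _ => PMF.pure (some 0)⟩, fun A => ⟨?_, by simp [rate, hε]⟩⟩
  have hcorr : ∀ S w, correctProb q ⟨fun _ => PMF.pure (0, 0), fun _ _ _ _ =>
      PMF.pure (Classical.arbitrary X), fun _ => PMF.pure (some 0)⟩ A S w = 1 := by
    intro S w
    refine le_antisymm (correctProb_le_one ..) (le_iSup_of_le 1 ?_)
    rw [decisionProb_eq_mean, mean_run_succ, mean_run_zero, mean_step]
    simp [mean_pure, mean_const, Subsingleton.elim w 0]
  simp only [errorProb, hcorr]
  simpa using hε

end Symmetrization

/-! ### A committee with an honest majority -/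

section Committee

open Filter Topology
open scoped Classical

/-- The number of Byzantine sensors among the first `m`. -/
def byzantineCount (S : Set ℕ) (m : ℕ) : ℕ := {k ∈ Finset.range m | k ∈ S}.card

/-- The generating function of the number of Byzantine sensors, from the expansion
`(1 + δ) ^ |S ∩ [m]| = ∑ δ ^ |F|` over the sets `F ⊆ S ∩ [m]`. -/
lemma lintegral_pow_byzantineCount (β : unitInterval) (δ : ℝ≥0∞) (m : ℕ) :
    ∫⁻ S, (1 + δ) ^ byzantineCount S m ∂(setBernoulli (Set.univ : Set ℕ) β) =
      (1 + δ * ENNReal.ofReal β) ^ m := by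
  have hexp : ∀ S : Set ℕ, (1 + δ) ^ byzantineCount S m =
      ∑ F ∈ (Finset.range m).powerset,
        Set.indicator {S : Set ℕ | ↑F ⊆ S} (fun _ => δ ^ F.card) S := by
    intro S
    rw [byzantineCount, ← Finset.prod_const, Finset.prod_filter]
    have : ∀ k, (if k ∈ S then 1 + δ else 1) = 1 + (if k ∈ S then δ else 0) := by
      intro k; split_ifs <;> simp
    simp only [this, Finset.prod_one_add]
    refine Finset.sum_congr rfl fun F _ => ?_
    by_cases hF : ↑F ⊆ S
    · rw [Set.indicator_of_mem (show S ∈ {S : Set ℕ | ↑F ⊆ S} from hF),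
        Finset.prod_congr rfl fun k hk => if_pos (hF hk), Finset.prod_const]
    · rw [Set.indicator_of_notMem (show S ∉ {S : Set ℕ | ↑F ⊆ S} from hF)]
      obtain ⟨k, hk, hkS⟩ := Set.not_subset.1 hF
      exact Finset.prod_eq_zero hk (if_neg hkS)
  simp only [hexp]
  rw [lintegral_finsetSum _ fun F _ => measurable_const.indicator (measurableSet_subset F)]
  simp only [lintegral_indicator_const (measurableSet_subset _), setBernoulli_subset, ← mul_pow]
  rw [← Finset.card_range m, ← Finset.prod_const, Finset.prod_one_add, Finset.card_range]
  simp only [Finset.prod_const]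

/-- Chernoff's bound for a Byzantine majority in a large committee. -/
lemma exists_committee {β : unitInterval} (hβ : (β : ℝ) < 1 / 2) {κ : ℝ} (hκ : 0 < κ) :
    ∃ m : ℕ, setBernoulli (Set.univ : Set ℕ) β {S | m ≤ 2 * byzantineCount S m} ≤
      ENNReal.ofReal κ := by
  set b : ℝ := (β : ℝ)
  have hb0 : 0 ≤ b := β.2.1
  set δ : ℝ := 1 - 2 * b with hδ
  have hδ0 : 0 < δ := by linarith
  set s := Real.sqrt (1 + δ)
  have hs2 : s ^ 2 = 1 + δ := Real.sq_sqrt (by linarith)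
  have hs1 : 1 ≤ s := Real.one_le_sqrt.2 (by linarith)
  set t := (1 + δ * b) / s with ht
  have ht0 : 0 ≤ t := by positivity
  have ht1 : t < 1 := by
    rw [ht, div_lt_one (by linarith)]
    refine lt_of_pow_lt_pow_left₀ 2 (by linarith) ?_
    rw [hs2]
    have h1 : (1 + δ * b) ^ 2 = 1 + δ - δ ^ 2 * (1 - b ^ 2) := by rw [hδ]; ring
    have h2 : 0 < δ ^ 2 * (1 - b ^ 2) := mul_pos (by positivity) (by nlinarith)
    linarith
  obtain ⟨m, hm⟩ := ((tendsto_pow_atTop_nhds_zero_of_lt_one ht0 ht1).eventually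
    (ge_mem_nhds hκ)).exists
  refine ⟨m, ?_⟩
  have hmarkov := mul_meas_ge_le_lintegral₀ (μ := setBernoulli (Set.univ : Set ℕ) β)
    (f := fun S => (1 + ENNReal.ofReal δ) ^ byzantineCount S m) ?_ (ENNReal.ofReal (s ^ m))
  · rw [lintegral_pow_byzantineCount, ← ENNReal.ofReal_mul hδ0.le, ← ENNReal.ofReal_one,
      ← ENNReal.ofReal_add zero_le_one hδ0.le,
      ← ENNReal.ofReal_add zero_le_one (mul_nonneg hδ0.le hb0),
      ← ENNReal.ofReal_pow (by positivity)] at hmarkov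
    have hsub : {S : Set ℕ | m ≤ 2 * byzantineCount S m} ⊆
        {S | ENNReal.ofReal (s ^ m) ≤ ENNReal.ofReal (1 + δ) ^ byzantineCount S m} := by
      intro S hS
      rw [Set.mem_ofPred_eq, ← ENNReal.ofReal_pow (by linarith), ← hs2, ← pow_mul]
      exact ENNReal.ofReal_le_ofReal (pow_le_pow_right₀ hs1 hS)
    have hspos : 0 < s ^ m := by positivity
    refine (measure_mono hsub).trans ?_
    rw [mul_comm] at hmarkov
    refine (ENNReal.le_div_iff_mul_le (.inl (by simpa using hspos))
      (.inl ENNReal.ofReal_ne_top)).2 hmarkov |>.trans ?_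
    rw [← ENNReal.ofReal_div_of_pos hspos, ← div_pow]
    exact ENNReal.ofReal_le_ofReal hm
  · refine Measurable.aemeasurable ?_
    have hcount : Measurable fun S : Set ℕ => byzantineCount S m := by
      simp only [byzantineCount, Finset.card_filter]
      exact Finset.measurable_sum _ fun k _ =>
        Measurable.ite (measurableSet_mem k) measurable_const measurable_const
    exact measurable_const.pow hcount

end Committee

/-! ### The polling scheme over an error-free channel for the honest sensors -/

section Scheme

open scoped Classical

variable (m G : ℕ) {B : ℕ} (yes no : Fin B)

/-- Round `i` is accepted. The polling scheme is divided into rounds of `G + m` blocks, in each of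
which one symbol of the alphabet `Fin B` is received; `z b` is the one received in block `b`. In
the last `m` blocks of a round every member of the committee `{0, …, m - 1}` votes on whether the
first `G` symbols of the round are right; the round is accepted if a majority votes for `yes`. -/
def Accepted (z : ℕ → Fin B) (i : ℕ) : Prop :=
  m < 2 * {j ∈ Finset.range m | z (i * (G + m) + (G + j)) = yes}.card

/-- The number of accepted rounds before round `i`. -/
def successes (z : ℕ → Fin B) (i : ℕ) : ℕ := Nat.count (Accepted m G yes z) i

/-- The number of rejected rounds before round `i`. -/
def failures (z : ℕ → Fin B) (i : ℕ) : ℕ := Nat.count (fun i => ¬ Accepted m G yes z i) i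

/-- The sensor polled in block `b`: in the first `G` blocks of a round it is the committee member
whose number is the number of rounds rejected so far, so that a sensor transmits until one of its
rounds is rejected; then the members of the committee vote. -/
def sensorAt (z : ℕ → Fin B) (b : ℕ) : ℕ :=
  if b % (G + m) < G then failures m G yes z (b / (G + m)) else b % (G + m) - G

/-- The digits sent in round `i` have been received correctly. -/
def RoundCorrect (digit : ℕ → Fin B) (z : ℕ → Fin B) (i : ℕ) : Prop :=
  ∀ g < G, z (i * (G + m) + g) = digit (successes m G yes z i * G + g)

/-- The symbol that an honest sensor sends in block `b`: the next digits of the message are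
transmitted in the first `G` blocks of a round, and a vote on them in the other blocks. -/
def symbolAt (digit : ℕ → Fin B) (z : ℕ → Fin B) (b : ℕ) : Fin B :=
  if b % (G + m) < G then
    digit (successes m G yes z (b / (G + m)) * G + b % (G + m))
  else if RoundCorrect m G yes digit z (b / (G + m)) then yes else no

variable {m G yes no}

lemma accepted_congr {z z' : ℕ → Fin B} {i : ℕ} (h : ∀ b < (i + 1) * (G + m), z b = z' b) :
    Accepted m G yes z i ↔ Accepted m G yes z' i := by
  unfold Accepted
  have : ∀ j ∈ Finset.range m, (z (i * (G + m) + (G + j)) = yes ↔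
      z' (i * (G + m) + (G + j)) = yes) := by
    intro j hj
    rw [h _ (by rw [Finset.mem_range] at hj; rw [add_mul, one_mul]; omega)]
  rw [Finset.filter_congr this]

lemma successes_congr {z z' : ℕ → Fin B} {i : ℕ} (h : ∀ b < i * (G + m), z b = z' b) :
    successes m G yes z i = successes m G yes z' i := by
  induction i with
  | zero => simp [successes]
  | succ i ih =>
    have h1 := ih fun b hb => h b (hb.trans_le (Nat.mul_le_mul_right _ i.le_succ))
    simp only [successes, Nat.count_succ] at h1 ⊢
    simp only [h1, accepted_congr (yes := yes) h]

lemma failures_congr {z z' : ℕ → Fin B} {i : ℕ} (h : ∀ b < i * (G + m), z b = z' b) :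
    failures m G yes z i = failures m G yes z' i := by
  induction i with
  | zero => simp [failures]
  | succ i ih =>
    have h1 := ih fun b hb => h b (hb.trans_le (Nat.mul_le_mul_right _ i.le_succ))
    simp only [failures, Nat.count_succ] at h1 ⊢
    simp only [h1, accepted_congr (yes := yes) h]

lemma sensorAt_congr {z z' : ℕ → Fin B} {b : ℕ} (h : ∀ b' < b, z b' = z' b') :
    sensorAt m G yes z b = sensorAt m G yes z' b := by
  unfold sensorAt
  rw [failures_congr fun b' hb' => h b' (hb'.trans_le (Nat.div_mul_le_self _ _))]

lemma symbolAt_congr {digit z z' : ℕ → Fin B} {b : ℕ} (h : ∀ b' < b, z b' = z' b') :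
    symbolAt m G yes no digit z b = symbolAt m G yes no digit z' b := by
  unfold symbolAt
  have hb := Nat.div_add_mod' b (G + m)
  rw [successes_congr fun b' hb' => h b' (hb'.trans_le (Nat.div_mul_le_self _ _))]
  split_ifs with h1 h2 h3 h3 <;> first | rfl | (exfalso; revert h2 h3; unfold RoundCorrect)
  all_goals
    rw [successes_congr fun b' hb' => h b' (hb'.trans_le (Nat.div_mul_le_self _ _))]
    intro h2 h3
  · exact h3 fun g hg => by rw [← h _ (by omega)]; exact h2 g hg
  · exact h2 fun g hg => by rw [h _ (by omega)]; exact h3 g hg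

lemma successes_add_failures (z : ℕ → Fin B) (i : ℕ) :
    successes m G yes z i + failures m G yes z i = i := by
  induction i with
  | zero => simp [successes, failures]
  | succ i ih =>
    simp only [successes, failures, Nat.count_succ] at ih ⊢
    split_ifs with h <;> omega

lemma exists_accepted (z : ℕ → Fin B) (i s : ℕ) (hs : s < successes m G yes z i) :
    ∃ i' < i, Accepted m G yes z i' ∧ successes m G yes z i' = s := by
  induction i with
  | zero => simp [successes] at hs
  | succ i ih =>
    by_cases h : s < successes m G yes z i
    · obtain ⟨i', hi', h'⟩ := ih h
      exact ⟨i', hi'.trans i.lt_succ_self, h'⟩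
    · simp only [successes, Nat.count_succ] at hs h ⊢
      split_ifs at hs with hacc
      · exact ⟨i, i.lt_succ_self, hacc, by omega⟩
      · omega

section Correctness

variable {S : Set ℕ} {n : ℕ} {digit z : ℕ → Fin B}

/-- With an honest majority in the committee, the votes are right. -/
lemma accepted_iff (hne : yes ≠ no) (hS : 2 * byzantineCount S m < m)
    (hz : ∀ b < n * (G + m), sensorAt m G yes z b ∉ S → z b = symbolAt m G yes no digit z b)
    {i : ℕ} (hi : i < n) : Accepted m G yes z i ↔ RoundCorrect m G yes digit z i := by
  have hvote : ∀ j < m, j ∉ S → z (i * (G + m) + (G + j)) =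
      if RoundCorrect m G yes digit z i then yes else no := by
    intro j hj hjS
    have hmod : (i * (G + m) + (G + j)) % (G + m) = G + j := by
      rw [add_comm, Nat.add_mul_mod_self_right, Nat.mod_eq_of_lt (by omega)]
    have hdiv : (i * (G + m) + (G + j)) / (G + m) = i := by
      rw [add_comm, Nat.add_mul_div_right _ _ (by omega), Nat.div_eq_of_lt (by omega), zero_add]
    have hlt : i * (G + m) + (G + j) < n * (G + m) := by
      have := Nat.mul_le_mul_right (G + m) (Nat.succ_le_of_lt hi)
      rw [Nat.succ_mul] at this
      omega
    rw [hz _ hlt]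
    · rw [symbolAt, hmod, hdiv, if_neg (by omega)]
    · rwa [sensorAt, hmod, if_neg (by omega), Nat.add_sub_cancel_left]
  have hsplit := Finset.card_filter_add_card_filter_not (s := Finset.range m) (fun k => k ∈ S)
  rw [Finset.card_range] at hsplit
  unfold byzantineCount at hS
  unfold Accepted
  constructor
  · intro hacc
    by_contra hcor
    have hsub : {j ∈ Finset.range m | z (i * (G + m) + (G + j)) = yes} ⊆
        {k ∈ Finset.range m | k ∈ S} := by
      intro j hj
      rw [Finset.mem_filter, Finset.mem_range] at hj ⊢
      refine ⟨hj.1, ?_⟩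
      by_contra hjS
      rw [hvote j hj.1 hjS, if_neg hcor] at hj
      exact hne hj.2.symm
    have := Finset.card_le_card hsub
    omega
  · intro hcor
    have hsub : {k ∈ Finset.range m | k ∉ S} ⊆
        {j ∈ Finset.range m | z (i * (G + m) + (G + j)) = yes} := by
      intro j hj
      rw [Finset.mem_filter, Finset.mem_range] at hj ⊢
      exact ⟨hj.1, by rw [hvote j hj.1 hj.2, if_pos hcor]⟩
    have := Finset.card_le_card hsub
    omega

/-- An honest transmitter never fails, so there are fewer rejected rounds than committee
members. -/
lemma failures_lt (hne : yes ≠ no) (hS : 2 * byzantineCount S m < m)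
    (hz : ∀ b < n * (G + m), sensorAt m G yes z b ∉ S → z b = symbolAt m G yes no digit z b)
    {i : ℕ} (hi : i ≤ n) : failures m G yes z i < m := by
  obtain ⟨f, hfm, hfS⟩ : ∃ f < m, f ∉ S := by
    by_contra! h
    have : {k ∈ Finset.range m | k ∈ S} = Finset.range m :=
      Finset.filter_true_of_mem fun k hk => h k (Finset.mem_range.1 hk)
    rw [byzantineCount, this, Finset.card_range] at hS
    omega
  suffices h : failures m G yes z i ≤ f by omega
  induction i with
  | zero => simp [failures]
  | succ i ih =>
    have ih := ih (by omega)
    have hstep : failures m G yes z (i + 1) =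
        failures m G yes z i + if ¬ Accepted m G yes z i then 1 else 0 := Nat.count_succ _ _
    rw [hstep]
    by_cases hacc : Accepted m G yes z i
    · simpa [hacc] using ih
    rw [if_pos hacc]
    by_contra hlt
    have hfi : failures m G yes z i = f := by omega
    refine hacc ((accepted_iff hne hS hz (by omega)).2 fun g hg => ?_)
    have hmod : (i * (G + m) + g) % (G + m) = g := by
      rw [add_comm, Nat.add_mul_mod_self_right, Nat.mod_eq_of_lt (by omega)]
    have hdiv : (i * (G + m) + g) / (G + m) = i := by
      rw [add_comm, Nat.add_mul_div_right _ _ (by omega), Nat.div_eq_of_lt (by omega), zero_add]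
    have hlt : i * (G + m) + g < n * (G + m) := by
      have := Nat.mul_le_mul_right (G + m) hi
      rw [Nat.succ_mul] at this
      omega
    rw [hz _ hlt]
    · rw [symbolAt, hmod, hdiv, if_pos hg]
    · rwa [sensorAt, hmod, hdiv, if_pos hg, hfi]

/-- After `J + m` rounds, the first `J * G` digits are determined by the accepted rounds. -/
lemma digit_eq_of_accepted (hne : yes ≠ no) (hS : 2 * byzantineCount S m < m) {J : ℕ}
    (hz : ∀ b < (J + m) * (G + m), sensorAt m G yes z b ∉ S →
      z b = symbolAt m G yes no digit z b) {digit' : ℕ → Fin B}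
    (h' : ∀ i < J + m, Accepted m G yes z i → RoundCorrect m G yes digit' z i) {p : ℕ}
    (hp : p < J * G) : digit' p = digit p := by
  have hG : 0 < G := Nat.pos_of_ne_zero (by rintro rfl; simp at hp)
  have hfail := failures_lt hne hS hz le_rfl
  have hadd := successes_add_failures (m := m) (G := G) (yes := yes) z (J + m)
  have hpJ : p / G < J := Nat.div_lt_of_lt_mul (by rwa [mul_comm])
  obtain ⟨i, hi, hacc, hsucc⟩ := exists_accepted (m := m) (G := G) (yes := yes) z (J + m) (p / G)
    (by omega)
  have h1 := h' i hi hacc (p % G) (Nat.mod_lt _ hG)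
  have h2 := (accepted_iff hne hS hz hi).1 hacc (p % G) (Nat.mod_lt _ hG)
  rw [hsucc, Nat.div_add_mod'] at h1 h2
  rw [← h1, ← h2]

end Correctness

end Scheme

/-! ### Block coding for the polling protocol -/

section Blocks

open scoped Classical

/-- A polling scheme in blocks of `n` time slots. The sensor polled in a block, and the element of
`Fin B` that an honest sensor encodes with the codebook `cw`, depend on the decoded blocks
`z : ℕ → Fin B`; only the values on earlier blocks matter (`sensor_congr`, `symbol_congr`). -/
structure BlockScheme (X Y : Type*) (M n B : ℕ) where
  /-- the codewords -/
  cw : Fin B → Fin n → X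
  /-- the decoder of a block -/
  dec : (Fin n → Y) → Fin B
  /-- the sensor polled in a block -/
  sensor : (ℕ → Fin B) → ℕ → ℕ
  /-- the symbol that an honest sensor encodes in a block -/
  symbol : Fin M → (ℕ → Fin B) → ℕ → Fin B
  /-- the final estimate of the message -/
  out : (ℕ → Fin B) → Fin M
  /-- the number of blocks -/
  len : ℕ
  /-- an arbitrary symbol, read off in place of those not yet received -/
  pad : Y
  sensor_congr : ∀ z z' b, (∀ b' < b, z b' = z' b') → sensor z b = sensor z' b
  symbol_congr : ∀ w z z' b, (∀ b' < b, z b' = z' b') → symbol w z b = symbol w z' b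

namespace BlockScheme

variable {X Y : Type*} {M n B : ℕ} (s : BlockScheme X Y M n B)

/-- The sequence of received symbols, from the list with the most recent one first. -/
def received (l : List Y) (t : ℕ) : Y := l.reverse.getD t s.pad

/-- The decoded blocks. -/
def decoded (l : List Y) (b : ℕ) : Fin B := s.dec fun i => s.received l (b * n + i)

lemma received_cons_of_lt (l : List Y) (y : Y) {t : ℕ} (ht : t < l.length) :
    s.received (y :: l) t = s.received l t := by
  rw [received, received, List.reverse_cons, List.getD_append _ _ _ _ (by simpa using ht)]

lemma received_cons_length (l : List Y) (y : Y) : s.received (y :: l) l.length = y := by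
  simp [received]

lemma decoded_cons_of_lt (l : List Y) (y : Y) {b : ℕ} (hb : (b + 1) * n ≤ l.length) :
    s.decoded (y :: l) b = s.decoded l b := by
  unfold decoded
  congr 1
  funext i
  refine s.received_cons_of_lt l y (lt_of_lt_of_le ?_ hb)
  rw [add_mul, one_mul]
  omega

variable [NeZero n]

/-- The deterministic code of fixed length `s.len * n` given by a block scheme. -/
def code : Code X Y M where
  poll v := PMF.pure (s.sensor (s.decoded (v.map fun r => r.2.2)) (v.length / n), 0)
  encode _ w v _ := PMF.pure (s.cw (s.symbol w (s.decoded (v.map fun r => r.2.1)) (v.length / n))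
    (Fin.ofNat n v.length))
  decide v := PMF.pure (if s.len * n ≤ v.length then
    some (s.out (s.decoded (v.map fun r => r.2.2))) else none)

/-- The received symbols of a history, the most recent one first. -/
abbrev outputs (h : History X Y) : List Y := h.map Round.received

variable (q : X → PMF Y) (A : Attack X Y M) (S : Set ℕ) (w : Fin M)

lemma mean_step_code (h : History X Y) (f : State X Y M → ℝ≥0∞) :
    mean (step q s.code A S w (h, none)) f =
      let k := s.sensor (s.decoded (outputs h)) (h.length / n)
      mean (if k ∈ S then A.send S w h k 0 else PMF.pure
        (s.cw (s.symbol w (s.decoded (outputs h)) (h.length / n)) (Fin.ofNat n h.length))) fun x =>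
        mean (q x) fun y => f (⟨k, 0, x, y⟩ :: h, if s.len * n ≤ h.length + 1 then
          some (s.out (s.decoded (y :: outputs h))) else none) := by
  have h1 : ∀ h : History X Y, (fusionView h).map (fun r => r.2.2) = outputs h := fun h => by
    simp [fusionView, outputs, Function.comp_def]
  have h2 : ∀ (k : ℕ) (h : History X Y), (sensorView k h).map (fun r => r.2.1) = outputs h :=
    fun k h => by simp [sensorView, outputs, Function.comp_def]
  have h3 : ∀ h : History X Y, (fusionView h).length = h.length := fun h => by simp [fusionView]
  have h4 : ∀ (k : ℕ) (h : History X Y), (sensorView k h).length = h.length :=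
    fun k h => by simp [sensorView]
  simp only [mean_step, code, mean_pure, h1, h2, h3, h4, List.length_cons, List.map_cons]

/-- The code runs for exactly `s.len * n` time slots. -/
lemma run_code_support (hlen : 0 < s.len) (t : ℕ) (a : State X Y M)
    (ha : run q s.code A S w t a ≠ 0) : a.1.length = min t (s.len * n) ∧
      a.2 = if s.len * n ≤ t then some (s.out (s.decoded (outputs a.1))) else none := by
  have hT : 0 < s.len * n := Nat.mul_pos hlen (NeZero.pos n)
  have key : ∀ t, mean (run q s.code A S w t) (fun a => if a.1.length = min t (s.len * n) ∧
      a.2 = (if s.len * n ≤ t then some (s.out (s.decoded (outputs a.1))) else none)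
      then 0 else 1) = 0 := by
    intro t
    induction t with
    | zero =>
      rw [mean_run_zero, if_pos]
      exact ⟨by simp, by rw [if_neg (by omega)]⟩
    | succ t ih =>
      rw [mean_run_succ, ← nonpos_iff_eq_zero]
      refine le_trans (mean_mono _ fun a _ => ?_) ih.le
      by_cases ha : a.1.length = min t (s.len * n) ∧
        a.2 = (if s.len * n ≤ t then some (s.out (s.decoded (outputs a.1))) else none)
      swap
      · rw [if_neg ha]
        refine (mean_mono _ fun b _ => ?_).trans (mean_const _ 1).le
        split_ifs <;> simp
      rw [if_pos ha]
      obtain ⟨h, d⟩ := a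
      obtain ⟨h1, h2⟩ := ha
      dsimp only at h1 h2
      split_ifs at h2 with ht
      · subst h2
        rw [mean_step_stopped, if_pos]
        refine ⟨by dsimp only; omega, by rw [if_pos (by omega)]⟩
      · subst h2
        rw [mean_step_code]
        refine (mean_mono _ fun x _ => mean_mono _ fun y _ => ?_).trans
          ((mean_mono _ fun x _ => (mean_const _ 0).le).trans (mean_const _ 0).le)
        rw [if_pos]
        have hl : h.length = t := by omega
        refine ⟨by simp only [List.length_cons]; omega, ?_⟩
        simp only [hl, outputs, List.map_cons]
  have h0 := key t
  rw [mean, ENNReal.tsum_eq_zero] at h0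
  by_contra hcon
  have := h0 a
  rw [if_neg hcon, mul_one] at this
  exact ha this

lemma decisionProb_code_none (hlen : 0 < s.len) (t : ℕ) :
    decisionProb q s.code A S w t none = if t < s.len * n then 1 else 0 := by
  rw [decisionProb_eq_mean]
  refine (mean_congr _ fun a ha => ?_).trans (mean_const _ _)
  rw [(s.run_code_support q A S w hlen t a ha).2]
  split_ifs <;> first | rfl | omega | simp_all

lemma expectedLength_code (hlen : 0 < s.len) (hM : 0 < M) (β : unitInterval) :
    expectedLength q s.code A β = (s.len * n : ℕ) := by
  have h1 : ∀ S w, expectedLengthGiven q s.code A S w = (s.len * n : ℕ) := by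
    intro S w
    simp only [expectedLengthGiven, s.decisionProb_code_none q A S w hlen]
    rw [tsum_eq_sum (s := Finset.range (s.len * n)) fun t ht => by
      rw [if_neg (by simpa using ht)]]
    rw [Finset.sum_congr rfl fun t ht => if_pos (Finset.mem_range.1 ht)]
    simp
  simp only [expectedLength, h1, Finset.sum_const, Finset.card_univ, Fintype.card_fin,
    nsmul_eq_mul, lintegral_const, measure_univ, mul_one]
  rw [mul_comm, ENNReal.mul_div_cancel_right (by exact_mod_cast hM.ne')
    (ENNReal.natCast_ne_top M)]

variable [Fintype Y]

omit [NeZero n] in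
/-- Averaging one coordinate of a product distribution separately. -/
lemma sum_mul_sum_update (p : Fin n → PMF Y) (j : Fin n) (F : (Fin n → Y) → ℝ≥0∞) :
    ∑ a, p j a * ∑ y : Fin n → Y, (∏ i, p i (y i)) * F (Function.update y j a) =
      ∑ y : Fin n → Y, (∏ i, p i (y i)) * F y := by
  obtain ⟨n, rfl⟩ : ∃ n', n = n' + 1 := ⟨n - 1, by have := j.pos; omega⟩
  have hone : ∑ a, p j a = 1 := by rw [← tsum_fintype (L := .unconditional Y), PMF.tsum_coe]
  have hsum : ∀ H : (Fin (n + 1) → Y) → ℝ≥0∞, ∑ y, H y =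
      ∑ a, ∑ y : Fin n → Y, H (j.insertNth a y) := by
    intro H
    rw [← Equiv.sum_comp (Fin.insertNthEquiv (fun _ => Y) j) H, Fintype.sum_prod_type]
    rfl
  simp only [hsum, Fin.prod_univ_succAbove _ j, Fin.insertNth_apply_same,
    Fin.insertNth_apply_succAbove, Fin.update_insertNth, mul_assoc]
  refine Finset.sum_congr rfl fun a _ => ?_
  simp only [← Finset.mul_sum, ← Finset.sum_mul]
  rw [hone, one_mul]

/-- The conditional probability, given the history `h`, that the honest sensor polled in block `b`
is misunderstood, if the remaining symbols of the block are those of its codeword. A block of a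
Byzantine sensor does not count. -/
def blockError (b : ℕ) (h : History X Y) : ℝ≥0∞ :=
  if s.sensor (s.decoded (outputs h)) b ∈ S then 0 else
    ∑ y : Fin n → Y, (∏ i, q (s.cw (s.symbol w (s.decoded (outputs h)) b) i) (y i)) *
      if s.dec (fun i => if b * n + i < h.length then s.received (outputs h) (b * n + i) else y i) =
        s.symbol w (s.decoded (outputs h)) b then 0 else 1

omit [NeZero n] in
lemma blockError_le_of_length_le {η : ℝ≥0∞} (hη : ∀ z, ∑ y, (∏ i, q (s.cw z i) (y i)) *
      (if s.dec y = z then 0 else 1) ≤ η) {b : ℕ} {h : History X Y} (hb : h.length ≤ b * n) :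
    s.blockError q S w b h ≤ η := by
  unfold blockError
  split_ifs
  · exact zero_le
  · have : ∀ i : Fin n, ¬ (b * n + i < h.length) := fun i => by omega
    simp only [this, if_false]
    exact hη _

omit [NeZero n] in
/-- After the end of the block, `blockError` is the indicator of an error. -/
lemma blockError_of_le_length {b : ℕ} {h : History X Y} (hb : (b + 1) * n ≤ h.length)
    (hS : s.sensor (s.decoded (outputs h)) b ∉ S)
    (hne : s.decoded (outputs h) b ≠ s.symbol w (s.decoded (outputs h)) b) :
    s.blockError q S w b h = 1 := by
  rw [add_mul, one_mul] at hb
  have : ∀ i : Fin n, b * n + i < h.length := fun i => by omega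
  unfold blockError
  rw [if_neg hS]
  simp only [this, if_true]
  change ∑ y : Fin n → Y, _ * (if s.decoded (outputs h) b = _ then 0 else 1) = 1
  simp only [hne, if_false, mul_one]
  rw [← Fintype.prod_sum (fun i y => q (s.cw (s.symbol w (s.decoded (outputs h)) b) i) y)]
  refine Finset.prod_eq_one fun i _ => ?_
  rw [← tsum_fintype (L := .unconditional Y), PMF.tsum_coe]

/-- During and after block `b`, the conditional error probability is a supermartingale, whatever the
Byzantine sensors do: they are not polled in a block that counts. -/
lemma mean_step_blockError_le {b : ℕ} {h : History X Y} (hb : b * n ≤ h.length) :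
    mean (step q s.code A S w (h, none)) (fun a => s.blockError q S w b a.1) ≤
      s.blockError q S w b h := by
  have hn : 0 < n := NeZero.pos n
  have hdec : ∀ (y : Y), ∀ b' < b, s.decoded (y :: outputs h) b' = s.decoded (outputs h) b' := by
    intro y b' hb'
    refine s.decoded_cons_of_lt _ _ ?_
    simp only [outputs, List.length_map]
    exact (Nat.mul_le_mul_right n hb').trans hb
  have hsens : ∀ y, s.sensor (s.decoded (y :: outputs h)) b = s.sensor (s.decoded (outputs h)) b :=
    fun y => s.sensor_congr _ _ _ (hdec y)
  have hsym : ∀ y, s.symbol w (s.decoded (y :: outputs h)) b =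
      s.symbol w (s.decoded (outputs h)) b := fun y => s.symbol_congr _ _ _ _ (hdec y)
  rw [mean_step_code]
  dsimp only
  simp only [blockError, outputs, List.map_cons, List.length_cons]
  simp only [outputs] at hsens hsym
  simp only [hsens, hsym]
  by_cases hS : s.sensor (s.decoded (h.map Round.received)) b ∈ S
  · simp only [hS, if_true, mean_const, le_refl]
  simp only [hS, if_false]
  rcases lt_or_ge h.length (b * n + n) with hlt | hge
  · have hdiv : h.length / n = b := by
      rw [Nat.div_eq_iff hn]
      rw [mul_comm] at hb hlt
      constructor <;> · rw [mul_comm]; omega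
    have hmod : ((Fin.ofNat n h.length : Fin n) : ℕ) = h.length - b * n := by
      simp only [Fin.ofNat]
      have := Nat.div_add_mod' h.length n
      rw [hdiv] at this
      omega
    rw [hdiv, if_neg hS, mean_pure, mean_fintype]
    set u := s.symbol w (s.decoded (h.map Round.received)) b
    set j : Fin n := Fin.ofNat n h.length
    refine le_of_eq ?_
    rw [← sum_mul_sum_update (fun i => q (s.cw u i)) j (fun y => if s.dec (fun i =>
      if b * n + i < h.length then s.received (h.map Round.received) (b * n + i) else y i) = u
      then 0 else 1)]
    refine Finset.sum_congr rfl fun a _ => ?_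
    congr 1
    refine Finset.sum_congr rfl fun y _ => ?_
    have hmix : (fun i : Fin n => if b * n + i < h.length + 1 then
        s.received (a :: h.map Round.received) (b * n + i) else y i) =
        fun i : Fin n => if b * n + i < h.length then
          s.received (h.map Round.received) (b * n + i) else Function.update y j a i := by
      funext i
      rcases lt_trichotomy (b * n + i) h.length with hi | hi | hi
      · rw [if_pos (by omega), if_pos hi]
        exact s.received_cons_of_lt _ _ (by simpa using hi)
      · have hij : i = j := by ext; rw [hmod]; omega
        have := s.received_cons_length (h.map Round.received) a
        rw [List.length_map] at this
        rw [if_pos (by omega), if_neg (by omega), hi, this, hij, Function.update_self]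
      · have hij : i ≠ j := fun hij => by
          have := congrArg Fin.val hij
          rw [hmod] at this
          omega
        rw [if_neg (by omega), if_neg (by omega), Function.update_of_ne hij]
    rw [hmix]
  · have hlt : ∀ i : Fin n, b * n + i < h.length := fun i => by omega
    have hlt' : ∀ i : Fin n, b * n + i < h.length + 1 := fun i => by omega
    have hrec : ∀ (y : Y) (i : Fin n), s.received (y :: h.map Round.received) (b * n + i) =
        s.received (h.map Round.received) (b * n + i) := fun y i =>
      s.received_cons_of_lt _ _ (by simpa using hlt i)
    simp only [hlt, hlt', if_true, hrec, mean_const, le_refl]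

lemma mean_run_blockError_le {η : ℝ≥0∞} (hη : ∀ z, ∑ y, (∏ i, q (s.cw z i) (y i)) *
      (if s.dec y = z then 0 else 1) ≤ η) {b : ℕ} (hb : b < s.len) :
    mean (run q s.code A S w (s.len * n)) (fun a => s.blockError q S w b a.1) ≤ η := by
  set V : State X Y M → ℝ≥0∞ := fun a =>
    if a.1.length < b * n then η else s.blockError q S w b a.1 with hV
  have hstep : ∀ a, mean (step q s.code A S w a) V ≤ V a := by
    rintro ⟨h, _ | v⟩
    · rcases lt_or_ge h.length (b * n) with hlt | hge
      · have : V (h, none) = η := if_pos hlt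
        rw [this, mean_step_code]
        refine (mean_mono _ fun x _ => (mean_mono _ fun y _ => ?_).trans (mean_const _ η).le).trans
          (mean_const _ η).le
        simp only [hV]
        split_ifs
        · exact le_rfl
        · exact s.blockError_le_of_length_le q S w hη (by simpa using hlt)
      · have h1 : V (h, none) = s.blockError q S w b h := if_neg (not_lt.2 hge)
        rw [h1]
        refine le_trans (le_of_eq ?_) (s.mean_step_blockError_le q A S w hge)
        rw [mean_step_code, mean_step_code]
        have h2 : ¬ h.length + 1 < b * n := by omega
        simp only [hV, List.length_cons, h2, if_false]
    · rw [mean_step_stopped]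
  have hrun : ∀ t, mean (run q s.code A S w t) V ≤ V ([], none) := by
    intro t
    induction t with
    | zero => rw [mean_run_zero]
    | succ t ih =>
      rw [mean_run_succ]
      exact (mean_mono _ fun a _ => hstep a).trans ih
  have hV0 : V ([], none) ≤ η := by
    simp only [hV]
    split_ifs
    · exact le_rfl
    · exact s.blockError_le_of_length_le q S w hη (by simp)
  refine le_trans (mean_mono _ fun a ha => ?_) ((hrun (s.len * n)).trans hV0)
  have hl := (s.run_code_support q A S w (by omega) _ a ha).1
  have : b * n ≤ s.len * n := Nat.mul_le_mul_right n hb.le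
  simp only [hV]
  rw [if_neg (by omega)]

/-- If the scheme is correct over a channel that is error-free for the honest sensors in the
complement of `S`, then the code is correct with high probability, by a union bound over the
blocks. -/
lemma one_sub_correctProb_code_le {η : ℝ≥0∞} (hη : ∀ z, ∑ y, (∏ i, q (s.cw z i) (y i)) *
      (if s.dec y = z then 0 else 1) ≤ η) (hlen : 0 < s.len)
    (hcorrect : ∀ z, (∀ b < s.len, s.sensor z b ∉ S → z b = s.symbol w z b) → s.out z = w) :
    1 - correctProb q s.code A S w ≤ s.len * η := by
  rw [tsub_le_iff_left]
  calc (1 : ℝ≥0∞) = mean (run q s.code A S w (s.len * n)) fun _ => 1 := (mean_const _ _).symm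
    _ ≤ mean (run q s.code A S w (s.len * n)) fun a => (if a.2 = some w then 1 else 0) +
          ∑ b ∈ Finset.range s.len, s.blockError q S w b a.1 := by
        refine mean_mono _ fun a ha => ?_
        obtain ⟨h1, h2⟩ := s.run_code_support q A S w hlen _ a ha
        rw [min_self] at h1
        rw [if_pos le_rfl] at h2
        by_cases hw : a.2 = some w
        · rw [if_pos hw]; exact le_self_add
        have hne : s.out (s.decoded (outputs a.1)) ≠ w := fun h => hw (by rw [h2, h])
        have := mt (hcorrect _) hne
        push Not at this
        obtain ⟨b, hb, hbS, hbne⟩ := this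
        refine le_trans ?_ le_add_self
        rw [← s.blockError_of_le_length q S w (h := a.1) (b := b)
          (h1 ▸ Nat.mul_le_mul_right n hb) hbS hbne]
        exact Finset.single_le_sum (f := fun b => s.blockError q S w b a.1) (fun _ _ => zero_le)
          (Finset.mem_range.2 hb)
    _ ≤ correctProb q s.code A S w + s.len * η := by
        rw [mean_add, mean_sum]
        refine add_le_add ?_ ?_
        · rw [← decisionProb_eq_mean]
          exact le_iSup (fun n => decisionProb q s.code A S w n (some w)) _
        · refine (Finset.sum_le_sum fun b hb =>
            s.mean_run_blockError_le q A S w hη (Finset.mem_range.1 hb)).trans ?_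
          simp

end BlockScheme

end Blocks

/-! ### Achievability of the Shannon capacity against a Byzantine minority -/

section Achievability

open Filter Topology
open scoped Classical

variable {X Y : Type*} {n B : ℕ}

/-- The base-`B` digits of a message, with irrelevant digits `no` behind the last one. -/
def digits (K : ℕ) (no : Fin B) (w : Fin (B ^ K)) (p : ℕ) : Fin B :=
  if h : p < K then finFunctionFinEquiv.symm w ⟨p, h⟩ else no

lemma digits_injective {K : ℕ} {no : Fin B} {w w' : Fin (B ^ K)}
    (h : ∀ p < K, digits K no w p = digits K no w' p) : w = w' := by
  refine finFunctionFinEquiv.symm.injective (funext fun p => ?_)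
  have := h p p.2
  simpa only [digits, p.2, dif_pos, Fin.eta] using this

/-- The polling scheme with committee `{0, …, m - 1}` and `J + m` rounds for a message of `J * G`
digits; the estimate is a message that agrees with all accepted rounds. -/
def votingScheme (m G J : ℕ) (yes no : Fin B) (hB : 0 < B) (cw : Fin B → Fin n → X)
    (dec : (Fin n → Y) → Fin B) (y₀ : Y) : BlockScheme X Y (B ^ (J * G)) n B where
  cw := cw
  dec := dec
  sensor := sensorAt m G yes
  symbol w := symbolAt m G yes no (digits (J * G) no w)
  out z := if h : ∃ w, ∀ i < J + m, Accepted m G yes z i →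
    RoundCorrect m G yes (digits (J * G) no w) z i then h.choose else ⟨0, Nat.pow_pos hB⟩
  len := (J + m) * (G + m)
  pad := y₀
  sensor_congr _ _ _ h := sensorAt_congr h
  symbol_congr _ _ _ _ h := symbolAt_congr h

lemma votingScheme_out {m G J : ℕ} {yes no : Fin B} {hB : 0 < B} {cw : Fin B → Fin n → X}
    {dec : (Fin n → Y) → Fin B} {y₀ : Y} (hne : yes ≠ no) {S : Set ℕ}
    (hS : 2 * byzantineCount S m < m) {w : Fin (B ^ (J * G))} {z : ℕ → Fin B}
    (hz : ∀ b < (J + m) * (G + m), sensorAt m G yes z b ∉ S →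
      z b = symbolAt m G yes no (digits (J * G) no w) z b) :
    (votingScheme m G J yes no hB cw dec y₀).out z = w := by
  have h : ∃ w, ∀ i < J + m, Accepted m G yes z i →
      RoundCorrect m G yes (digits (J * G) no w) z i :=
    ⟨w, fun i hi => (accepted_iff hne hS hz hi).1⟩
  have hout : (votingScheme m G J yes no hB cw dec y₀).out z = h.choose := dif_pos h
  rw [hout]
  exact digits_injective fun p hp => digit_eq_of_accepted hne hS hz h.choose_spec hp

theorem achievable_shannonCapacity [Fintype X] [Nonempty X] [Fintype Y] (q : X → PMF Y)
    {β : unitInterval} (hβ : (β : ℝ) < 1 / 2) : Achievable q β (shannonCapacity q) := by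
  set C := shannonCapacity q with hC
  rcases (shannonCapacity_nonneg q).eq_or_lt with h0 | hCpos
  · rw [hC, ← h0]; exact achievable_zero q β
  intro ε hε
  obtain ⟨m, hm⟩ := exists_committee hβ (show 0 < ε / 4 by positivity)
  set R := max (C - ε / 2) 0 with hR
  have hR0 : 0 ≤ R := le_max_right _ _
  have hRC : R < C := max_lt (by linarith) hCpos
  -- A fraction `(g / (g + m)) ^ 2` of all blocks carries message digits in accepted rounds.
  obtain ⟨g, hg0, hg⟩ : ∃ g : ℕ, 0 < g ∧ C - ε < ((g : ℝ) / (g + m)) ^ 2 * R := by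
    have h1 : Tendsto (fun g : ℕ => ((g : ℝ) / (g + m)) ^ 2 * R) atTop (𝓝 (1 ^ 2 * R)) :=
      ((tendsto_natCast_div_add_atTop (m : ℝ)).pow 2).mul_const R
    have h2 : C - ε < 1 ^ 2 * R := by
      have := le_max_left (C - ε / 2) 0
      rw [one_pow, one_mul]; linarith
    obtain ⟨g, hg⟩ := ((h1.eventually (lt_mem_nhds h2)).and (eventually_gt_atTop 0)).exists
    exact ⟨g, hg.2, hg.1⟩
  set L := (g + m) * (g + m) with hL
  have hL0 : 0 < L := by positivity
  have hL0' : (0 : ℝ) < L := by exact_mod_cast hL0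
  obtain ⟨n₀, hn₀⟩ := exists_block_code q hR0 hRC (show 0 < ε / 4 / L by positivity)
  obtain ⟨B, hB, hRB, cw, dec, hη⟩ := hn₀ (n₀ + 1) (by omega)
  obtain ⟨y₀, -⟩ := (q (Classical.arbitrary X)).support_nonempty
  have hne : (⟨1, hB⟩ : Fin B) ≠ ⟨0, by omega⟩ := by simp
  set s := votingScheme m g g (⟨1, hB⟩ : Fin B) ⟨0, by omega⟩ (by omega) cw dec y₀ with hs
  have hM : 0 < B ^ (g * g) := Nat.pow_pos (by omega)
  refine ⟨B ^ (g * g), hM, s.code, fun A => ⟨?_, ?_⟩⟩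
  · have hblocks : (L : ℝ≥0∞) * ENNReal.ofReal (ε / 4 / L) = ENNReal.ofReal (ε / 4) := by
      rw [← ENNReal.ofReal_natCast, ← ENNReal.ofReal_mul hL0'.le, mul_div_cancel₀ _ hL0'.ne']
    set bad := {S : Set ℕ | m ≤ 2 * byzantineCount S m}
    have hle : ∀ S, (∑ w, (1 - correctProb q s.code A S w)) / ((B ^ (g * g) : ℕ) : ℝ≥0∞) ≤
        bad.indicator (fun _ => 1) S + ENNReal.ofReal (ε / 4) := by
      intro S
      refine ENNReal.div_le_of_le_mul' ?_
      have hw : ∀ w, 1 - correctProb q s.code A S w ≤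
          bad.indicator (fun _ => 1) S + ENNReal.ofReal (ε / 4) := by
        intro w
        by_cases hS : S ∈ bad
        · rw [Set.indicator_of_mem hS]
          exact tsub_le_self.trans le_self_add
        · rw [Set.indicator_of_notMem hS, zero_add, ← hblocks]
          exact s.one_sub_correctProb_code_le q A S w hη hL0 fun z hz =>
            votingScheme_out hne (not_le.1 hS) hz
      refine (Finset.sum_le_sum fun w _ => hw w).trans (le_of_eq ?_)
      simp [mul_add]
    calc errorProb q s.code A β ≤ ∫⁻ S, bad.indicator (fun _ => 1) S + ENNReal.ofReal (ε / 4)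
          ∂(setBernoulli (Set.univ : Set ℕ) β) := lintegral_mono hle
      _ ≤ ENNReal.ofReal (ε / 4) + ENNReal.ofReal (ε / 4) := by
          rw [lintegral_add_right _ measurable_const]
          refine add_le_add ((lintegral_indicator_const_le _ _).trans ?_) (by simp)
          simpa using hm
      _ < ENNReal.ofReal ε := by
          rw [← ENNReal.ofReal_add (by positivity) (by positivity)]
          exact (ENNReal.ofReal_lt_ofReal_iff hε).2 (by linarith)
  · have hlen : s.len = L := rfl
    rw [rate, s.expectedLength_code q A hL0 hM β, hlen, ENNReal.toReal_natCast]
    refine hg.trans_le ?_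
    have hn : (0 : ℝ) < ((n₀ + 1 : ℕ) : ℝ) := by positivity
    have hgm : (0 : ℝ) < g + m := by positivity
    push_cast at hRB hn ⊢
    rw [Real.log_pow, hL, le_div_iff₀ (by push_cast; positivity)]
    push_cast
    calc ((g : ℝ) / (g + m)) ^ 2 * R * ((g + m) * (g + m) * (n₀ + 1))
        = g * g * ((n₀ + 1) * R) := by field_simp
      _ ≤ g * g * Real.log B := by gcongr

end Achievability

end ByzantineFusion

end

theorem mainTheorem1 {X Y : Type*} [Fintype X] [Nonempty X] [Fintype Y]
    (q : X → PMF Y) (β : unitInterval) :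
    IsGreatest (Set.range (ByzantineFusion.mutualInfo q)) (ByzantineFusion.shannonCapacity q) ∧
    ((β : ℝ) < 1 / 2 →
      IsGreatest {R : ℝ | ByzantineFusion.Achievable q β R} (ByzantineFusion.shannonCapacity q)) ∧
    (1 / 2 ≤ (β : ℝ) →
      IsGreatest {R : ℝ | ByzantineFusion.Achievable q β R} 0) :=
  ⟨ByzantineFusion.isGreatest_shannonCapacity q,
    fun hβ => ⟨ByzantineFusion.achievable_shannonCapacity q hβ,
      fun _ hR => ByzantineFusion.le_shannonCapacity_of_achievable q hR⟩,
    fun hβ => ⟨ByzantineFusion.achievable_zero q β,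
      fun _ hR => ByzantineFusion.le_zero_of_achievable_of_half_le q hβ hR⟩⟩
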